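/- **Setting.** Let $M>1$, tensor orders $K_m$ and factor numbers $r_{m,k},u_{m,k}$ ($m\in[M]$, $k\in[K_m]$) be fixed, and put $r_m=\prod_k r_{m,k}$. For each sample size $T$ let $p_{m,k}=p_{m,k}(T)\ge 1$ be dimensions, $p_m=\prod_k p_{m,k}$, and suppose that for $t\in[T]$ one observes the order-$K_m$ tensors $$\mathcal X_t^{(m)}=\mathcal G_t^{(m)}\times_{k=1}^{K_m}\mathbf A_{m,k}+\mathcal F_t^{(m)}\times_{k=1}^{K_m}\mathbf B_{m,k}+\mathcal E_t^{(m)},\qquad m\in[M],$$ with deterministic loadings $\mathbf A_{m,k}\in\mathbb R^{p_{m,k}\times r_{m,k}}$, $\mathbf B_{m,k}\in\mathbb R^{p_{m,k}\times u_{m,k}}$ and random global factors $\mathcal G_t^{(m)}$, local factors $\mathcal F_t^{(m)}$ and noise $\mathcal E_t^{(m)}$. All of these may vary with $T$; asymptotics are as $T\to\infty$, and constants do not depend on $T,t$ or on the indices of entries. $\mathrm{mat}_k$ is the mode-$k$ unfolding, $\sigma_j$ the $j$th largest singular value, $\|\cdot\|$ the spectral norm. **Assumptions.** 1. (Identification)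 All entries of $\mathcal G_t^{(m)},\mathcal F_t^{(m)}$ have mean zero and are uncorrelated with all entries of $\mathcal F_t^{(n)}$ for $n\ne m$. 2. (Loadings) For each $m,k$ there is a constant $c$ such that the entries of $\mathbf A_{m,k},\mathbf B_{m,k}$ are bounded by $c$ in absolute value and $\Delta_{m,k}:=\|p_{m,k}^{-1}(\mathbf A_{m,k},\mathbf B_{m,k})^\top(\mathbf A_{m,k},\mathbf B_{m,k})-\mathbf I\|\le c\,p_{m,k}^{-1/2}$. Moreover there is $\rho<1$ with $\Delta_{m,k}\le\rho$ for all large $T$ (automatic if $p_{m,k}\to\infty$). 3. (Core factors) (a) The entries of $\mathcal G_t^{(m)},\mathcal F_t^{(m)}$ have uniformly bounded fourth moments. (b) $T^{-1}\sum_t\mathrm{mat}_k(\mathcal F_t^{(m)})\mathrm{mat}_k(\mathcal F_t^{(m)})^\top$ converges in probability to a positive definite matrix. (c) For all $m,n\in[M]$, $k\in[K_m]$ and $0<a\le b$ there are constants $0<c\le C$ such that, for all large $T$ and all $\mathbf L_h\in\mathbb R^{p_{n,h}\times r_{n,h}}$ ($h\in[K_n]$) whose singular values $\sigma_1,\dots,\sigma_{r_{n,h}}$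 lie in $[a,b]$, $$c\le\sigma_j\Big(\frac1T\sum_{t=1}^T\mathbb E\big[\mathrm{mat}_k(\mathcal G_t^{(m)})\otimes\{\mathrm{vec}(\mathcal G_t^{(n)})^\top(\otimes_h\mathbf L_h)^\top\}\big]\Big)\le C,\qquad j\in[r_{m,k}].$$ 4. (Noise) (a) The entries of $\mathcal E_t^{(m)}$ have mean zero and uniformly bounded fourth moments. Writing $e_{t,ij}=\mathrm{mat}_k(\mathcal E_t^{(m)})_{ij}$, there is a constant $c$ such that for all $T$, all $t\in[T]$ and all $m,k,i,j,l_1,h_1$: (b) $\sum_{s=1}^T\sum_{l,h}|\mathbb E(e_{t,ij}e_{s,lh})|\le c$; (c) each of the sums over $s\in[T]$ and all $l_2,h_2$ of $|\mathrm{Cov}(e_{t,ij}e_{t,l_1j},e_{s,ih_2}e_{s,l_2h_2})|$, of $|\mathrm{Cov}(e_{t,ij}e_{t,ih_1},e_{s,l_2j}e_{s,l_2h_2})|$, of $|\mathrm{Cov}(e_{t,ij}e_{t,l_1h_1},e_{s,ij}e_{s,l_2h_2})|$ and of $|\mathrm{Cov}(e_{t,l_1j}e_{t,ih_1},e_{s,l_2j}e_{s,ih_2})|$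 is at most $c$. 5. (Dependence across threads) For $n\ne m$: (a) the entries of $\mathcal E_t^{(n)}$ are uncorrelated with those of $\mathcal X_t^{(m)}$ and with those of $\mathcal E_t^{(m)}$; (b) the entries of the covariance matrix of $T^{-1/2}\sum_t\mathrm{vec}(\mathcal Y_t)\otimes\mathrm{vec}(\mathcal Z_t)$ are bounded by a constant in absolute value for $(\mathcal Y,\mathcal Z)$ equal to each of $(\mathcal X^{(m)},\mathcal E^{(n)})$, $(\mathcal E^{(m)},\mathcal E^{(n)})$, $(\mathcal G^{(m)},\mathcal F^{(n)})$, $(\mathcal F^{(m)},\mathcal F^{(n)})$, $(\mathcal G^{(m)},\mathcal G^{(n)})$. **Estimator.** Fix $m$. For $n\ne m$ let $\mathcal S_n\subseteq[p_{n,1}]\times\dots\times[p_{n,K_n}]$ be random sets, jointly independent of the whole collection of observations $(\mathcal X_t^{(l)})_{t\in[T],l\in[M]}$, such that the probability that all $\mathcal S_n$ are empty tends to zero. For $k\in[K_m]$ let $$\widehat{\boldsymbol\Omega}_{k,n,\mathbf i}=\frac1T\sum_{t=1}^T\mathrm{mat}_k(\mathcal X_t^{(m)})(\mathcal X_t^{(n)})_{\mathbf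 i},\qquad \widehat{\boldsymbol\Sigma}^S_{m,k}=\sum_{n\ne m}\sum_{\mathbf i\in\mathcal S_n}\widehat{\boldsymbol\Omega}_{k,n,\mathbf i}\widehat{\boldsymbol\Omega}_{k,n,\mathbf i}^\top,$$ and let $\widehat{\mathbf A}^S_{m,k}$ be $\sqrt{p_{m,k}}$ times any choice of $r_{m,k}$ orthonormal leading eigenvectors of $\widehat{\boldsymbol\Sigma}^S_{m,k}$. **Theorem.** Let Assumptions 1–5 hold. Suppose in addition that for every $n\ne m$ all $r_n$ singular values of the submatrix of $\otimes_{k=1}^{K_n}\mathbf A_{n,k}$ formed by the rows with index in $\mathcal S_n$ are of exact order $|\mathcal S_n|^{1/2}$, in the sense that for every $\varepsilon>0$ there are constants $0<a\le b$ such that for all large $T$, with probability at least $1-\varepsilon$, $$a|\mathcal S_n|^{1/2}\le\sigma_j\big\{(\otimes_{k}\mathbf A_{n,k})_{\mathcal S_n}\big\}\le b|\mathcal S_n|^{1/2}\quad\text{for all } j\in[r_n].$$ Then for every $k\in[K_m]$, up to the rotational indeterminacy of the loading matrix, $$\frac1{p_{m,k}}\big\|\widehat{\mathbf A}^S_{m,k}-\mathbf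 A_{m,k}\mathbf H\big\|_F^2=O_P\Big(\frac1T\Big),$$ that is, for all large $T$ there are (random) $r_{m,k}\times r_{m,k}$ matrices $\mathbf H$ with $(\mathbf A_{m,k}\mathbf H)^\top(\mathbf A_{m,k}\mathbf H)=p_{m,k}\mathbf I$ for which this holds. So $\mathbf A_{m,k}\mathbf H$ is a loading matrix with the same column space as $\mathbf A_{m,k}$ and the same normalization as $\widehat{\mathbf A}^S_{m,k}$, and $\mathbf H$ is orthogonal when $\mathbf A_{m,k}^\top\mathbf A_{m,k}=p_{m,k}\mathbf I$. -/

import Mathlib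

open MeasureTheory ProbabilityTheory Filter Topology

noncomputable section

namespace MultiOrderTFM

/-! ## Tensors, Kronecker products, singular values -/

/-- Multi-indices `(i_1, …, i_K)` with `i_k ∈ [d_k]`. -/
abbrev MIdx {K : ℕ} (d : Fin K → ℕ) : Type := ∀ k : Fin K, Fin (d k)

/-- Real order-`K` tensors of dimension `d_1 × … × d_K`; read as a function on multi-indices,
a tensor is also its own vectorization. -/
abbrev Tensor {K : ℕ} (d : Fin K → ℕ) : Type := MIdx d → ℝ

/-- Multi-indices of the modes other than `k`: the column indices of the mode-`k` unfolding. -/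
abbrev CoIdx {K : ℕ} (d : Fin K → ℕ) (k : Fin K) : Type := ∀ j : {j : Fin K // j ≠ k}, Fin (d j)

/-- Mode-`k` unfolding. -/
def unfold {K : ℕ} {d : Fin K → ℕ} (k : Fin K) (Y : Tensor d) :
    Matrix (Fin (d k)) (CoIdx d k) ℝ :=
  Matrix.of fun i c => Y ((Equiv.piSplitAt k (fun j => Fin (d j))).symm (i, c))

/-- The Kronecker product of `A_1, …, A_K`, its rows and columns indexed by multi-indices. -/
def kron {K : ℕ} {p r : Fin K → ℕ} (A : ∀ k, Matrix (Fin (p k)) (Fin (r k)) ℝ) :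
    Matrix (MIdx p) (MIdx r) ℝ :=
  Matrix.of fun i a => ∏ k, A k (i k) (a k)

/-- The product `Y ×_1 A_1 ×_2 … ×_K A_K` of a tensor with one matrix along each mode. -/
def multiModeProd {K : ℕ} {p r : Fin K → ℕ} (Y : Tensor r)
    (A : ∀ k, Matrix (Fin (p k)) (Fin (r k)) ℝ) : Tensor p :=
  (kron A).mulVec Y

/-- The `(j+1)`-th largest singular value of a matrix. -/
def singVal {ι κ : Type*} [Fintype ι] [Fintype κ] [DecidableEq κ]
    (Y : Matrix ι κ ℝ) (j : ℕ) : ℝ :=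
  (Matrix.toEuclideanLin Y).singularValues j

/-- Squared Frobenius norm. -/
def frobSq {ι κ : Type*} [Fintype ι] [Fintype κ] (Y : Matrix ι κ ℝ) : ℝ :=
  ∑ i, ∑ j, Y i j ^ 2

/-- Spectral norm of a square matrix. -/
def specNorm {ι : Type*} [Fintype ι] [DecidableEq ι] (Y : Matrix ι ι ℝ) : ℝ :=
  ‖Matrix.toEuclideanCLM (n := ι) (𝕜 := ℝ) Y‖

/-- The columns of `V` are `r` orthonormal leading eigenvectors of the symmetric matrix `Y`:
they are the first `r` members of an orthonormal eigenbasis with eigenvalues in descending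
order. -/
def IsLeadingEigenvectors {p r : ℕ} (Y : Matrix (Fin p) (Fin p) ℝ)
    (V : Matrix (Fin p) (Fin r) ℝ) : Prop :=
  ∃ (h : r ≤ p) (b : OrthonormalBasis (Fin p) ℝ (EuclideanSpace ℝ (Fin p))) (ev : Fin p → ℝ),
    Antitone ev ∧ (∀ i, Matrix.toEuclideanLin Y (b i) = ev i • b i) ∧
      ∀ i j, V i j = b (Fin.castLE h j) i

/-- `Z_T = O_P(a_T)` as `T → ∞`. -/
def IsBigOP {Ω : Type*} [MeasurableSpace Ω] (μ : Measure Ω) (Z : ℕ → Ω → ℝ) (a : ℕ → ℝ) : Prop :=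
  ∀ ε : ℝ, 0 < ε → ∃ C : ℝ, 0 < C ∧
    ∀ᶠ T in atTop, μ {ω | C * a T < |Z T ω|} ≤ ENNReal.ofReal ε

/-! ## The model -/

/-- The latent ingredients of a multi-order tensor factor model with `M` threads, tensor orders
`K m` and factor numbers `r m k`, `u m k`. For every sample size `T` there are dimensions `p`,
loading matrices `A` (global) and `B` (local), and for each time `t ∈ [T]` random core factors `G`
(global), `F` (local) and noise tensors `E`. All of them may vary with `T`. -/
structure Model (Ω : Type*) [MeasurableSpace Ω] (M : ℕ) (K : Fin M → ℕ)
    (r u : ∀ m, Fin (K m) → ℕ) where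
  p : ℕ → ∀ m, Fin (K m) → ℕ
  p_pos : ∀ T m k, 0 < p T m k
  A : ∀ T m k, Matrix (Fin (p T m k)) (Fin (r m k)) ℝ
  B : ∀ T m k, Matrix (Fin (p T m k)) (Fin (u m k)) ℝ
  G : ∀ T, Fin T → ∀ m, Ω → Tensor (r m)
  F : ∀ T, Fin T → ∀ m, Ω → Tensor (u m)
  E : ∀ T, Fin T → ∀ m, Ω → Tensor (p T m)
  measurable_G : ∀ T t m, Measurable (G T t m)
  measurable_F : ∀ T t m, Measurable (F T t m)
  measurable_E : ∀ T t m, Measurable (E T t m)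

namespace Model

variable {Ω : Type*} [MeasurableSpace Ω] {M : ℕ} {K : Fin M → ℕ} {r u : ∀ m, Fin (K m) → ℕ}

/-- The observed tensors `X = G ×_k A_k + F ×_k B_k + E`. -/
def X (D : Model Ω M K r u) (T : ℕ) (t : Fin T) (m : Fin M) (ω : Ω) : Tensor (D.p T m) :=
  multiModeProd (D.G T t m ω) (D.A T m) + multiModeProd (D.F T t m ω) (D.B T m) + D.E T t m ω

/-! ## Estimation -/

/-- `T⁻¹ ∑_t mat_k(X_t^{(m)}) (X_t^{(n)})_i`. -/
def OmegaHat (D : Model Ω M K r u) (T : ℕ) (m : Fin M) (k : Fin (K m)) (n : Fin M)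
    (i : MIdx (D.p T n)) (ω : Ω) : Matrix (Fin (D.p T m k)) (CoIdx (D.p T m) k) ℝ :=
  (T : ℝ)⁻¹ • ∑ t : Fin T, D.X T t n ω i • unfold k (D.X T t m ω)

/-- The subsampled moment matrix, for subsets `S n`, `n ≠ m`, of the multi-indices. -/
def SigmaHatS (D : Model Ω M K r u) (T : ℕ) (m : Fin M) (k : Fin (K m))
    (S : ∀ n : {n : Fin M // n ≠ m}, Finset (MIdx (D.p T n))) (ω : Ω) :
    Matrix (Fin (D.p T m k)) (Fin (D.p T m k)) ℝ :=
  ∑ n : {n : Fin M // n ≠ m}, ∑ i ∈ S n,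
    D.OmegaHat T m k n i ω * (D.OmegaHat T m k n i ω).transpose

/-- `Ahat` is `√p_{m,k}` times `r_{m,k}` leading eigenvectors of the subsampled moment matrix. -/
def IsLoadingEstimator (D : Model Ω M K r u) (T : ℕ) (m : Fin M) (k : Fin (K m))
    (S : ∀ n : {n : Fin M // n ≠ m}, Finset (MIdx (D.p T n))) (ω : Ω)
    (Ahat : Matrix (Fin (D.p T m k)) (Fin (r m k)) ℝ) : Prop :=
  ∃ V, IsLeadingEigenvectors (D.SigmaHatS T m k S ω) V ∧ Ahat = √(D.p T m k : ℝ) • V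

/-- The rows of `⊗_k A_{n,k}` with index in `s`. -/
def kronRows (D : Model Ω M K r u) (T : ℕ) (n : Fin M) (s : Finset (MIdx (D.p T n))) :
    Matrix s (MIdx (r n)) ℝ :=
  (kron (D.A T n)).submatrix (fun i => (i : MIdx (D.p T n))) id

/-! ## Assumptions -/

/-- Mean zero core factors; local factors uncorrelated with both core factors of every other
thread. -/
def Identification (D : Model Ω M K r u) (μ : Measure Ω) : Prop :=
  (∀ T t m, (∀ a, ∫ ω, D.G T t m ω a ∂μ = 0) ∧ (∀ a, ∫ ω, D.F T t m ω a ∂μ = 0)) ∧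
  (∀ T t m n, n ≠ m →
    (∀ a b, cov[fun ω => D.G T t m ω a, fun ω => D.F T t n ω b; μ] = 0) ∧
    (∀ a b, cov[fun ω => D.F T t m ω a, fun ω => D.F T t n ω b; μ] = 0))

/-- `‖p⁻¹ (A, B)ᵀ (A, B) - I‖` for the loading matrices of thread `m` and mode `k`. -/
def gramError (D : Model Ω M K r u) (T : ℕ) (m : Fin M) (k : Fin (K m)) : ℝ :=
  specNorm ((D.p T m k : ℝ)⁻¹ •
    ((Matrix.fromCols (D.A T m k) (D.B T m k)).transpose *
      Matrix.fromCols (D.A T m k) (D.B T m k)) - 1)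

/-- Bounded loadings, asymptotically orthonormal after normalization. -/
def Loadings (D : Model Ω M K r u) : Prop :=
  ∀ m k, ∃ c : ℝ, ∀ T,
    (∀ i a, |D.A T m k i a| ≤ c) ∧ (∀ i b, |D.B T m k i b| ≤ c) ∧
    D.gramError T m k ≤ c * (√(D.p T m k : ℝ))⁻¹

/-- The normalized Gram matrices of the loadings stay within a distance smaller than one of the
identity. Given `Loadings` this holds as soon as all `p_{m,k}` diverge, but it also allows bounded
dimensions. -/
def LoadingsNondegenerate (D : Model Ω M K r u) : Prop :=
  ∀ m k, ∃ ρ : ℝ, ρ < 1 ∧ ∀ᶠ T in atTop, D.gramError T m k ≤ ρ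

/-- `T⁻¹ ∑_t E[mat_k(G_t^{(m)}) ⊗ {vec(G_t^{(n)})ᵀ (⊗_h L_h)ᵀ}]`: the row index is that of the
unfolding, the column index is a pair of a column of the unfolding and a row of `⊗_h L_h`. -/
def factorCrossMoment (D : Model Ω M K r u) (μ : Measure Ω) (T : ℕ) (m : Fin M) (k : Fin (K m))
    (n : Fin M) (L : ∀ h, Matrix (Fin (D.p T n h)) (Fin (r n h)) ℝ) :
    Matrix (Fin (r m k)) (CoIdx (r m) k × MIdx (D.p T n)) ℝ :=
  Matrix.of fun i c => (T : ℝ)⁻¹ * ∑ t : Fin T,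
    ∫ ω, unfold k (D.G T t m ω) i c.1 * (kron L).mulVec (D.G T t n ω) c.2 ∂μ

/-- Core factors: bounded fourth moments; the local factor second moments converge in probability
to positive definite matrices; nondegenerate cross moments of the global factors. -/
def CoreFactor (D : Model Ω M K r u) (μ : Measure Ω) : Prop :=
  (∃ c : ℝ, ∀ T t m,
    (∀ a, MemLp (fun ω => D.G T t m ω a) 4 μ ∧ ∫ ω, D.G T t m ω a ^ 4 ∂μ ≤ c) ∧
    (∀ a, MemLp (fun ω => D.F T t m ω a) 4 μ ∧ ∫ ω, D.F T t m ω a ^ 4 ∂μ ≤ c)) ∧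
  (∀ m k, ∃ Sig : Matrix (Fin (u m k)) (Fin (u m k)) ℝ, Sig.PosDef ∧
    ∀ i j, TendstoInMeasure μ
      (fun (T : ℕ) ω => (T : ℝ)⁻¹ * ∑ t : Fin T,
        (unfold k (D.F T t m ω) * (unfold k (D.F T t m ω)).transpose) i j)
      atTop (fun _ => Sig i j)) ∧
  (∀ m k n, ∀ a b : ℝ, 0 < a → a ≤ b → ∃ c C : ℝ, 0 < c ∧ ∀ᶠ T in atTop,
    ∀ L : ∀ h, Matrix (Fin (D.p T n h)) (Fin (r n h)) ℝ,
      (∀ h, ∀ j < r n h, a ≤ singVal (L h) j ∧ singVal (L h) j ≤ b) →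
      ∀ j < r m k, c ≤ singVal (D.factorCrossMoment μ T m k n L) j ∧
        singVal (D.factorCrossMoment μ T m k n L) j ≤ C)

/-- Idiosyncratic noise: mean zero, bounded fourth moments, weak dependence over time and
cross-section. -/
def Noise (D : Model Ω M K r u) (μ : Measure Ω) : Prop :=
  (∃ c : ℝ, ∀ T t m i, ∫ ω, D.E T t m ω i ∂μ = 0 ∧
    MemLp (fun ω => D.E T t m ω i) 4 μ ∧ ∫ ω, D.E T t m ω i ^ 4 ∂μ ≤ c) ∧
  (∃ c : ℝ, ∀ T t m k i j,
    ∑ s : Fin T, ∑ l, ∑ h,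
      |∫ ω, unfold k (D.E T t m ω) i j * unfold k (D.E T s m ω) l h ∂μ| ≤ c) ∧
  (∃ c : ℝ, ∀ T t m k i l₁ j h₁,
    ∑ s : Fin T, ∑ l₂, ∑ h₂,
      |cov[fun ω => unfold k (D.E T t m ω) i j * unfold k (D.E T t m ω) l₁ j,
        fun ω => unfold k (D.E T s m ω) i h₂ * unfold k (D.E T s m ω) l₂ h₂; μ]| ≤ c ∧
    ∑ s : Fin T, ∑ l₂, ∑ h₂,
      |cov[fun ω => unfold k (D.E T t m ω) i j * unfold k (D.E T t m ω) i h₁,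
        fun ω => unfold k (D.E T s m ω) l₂ j * unfold k (D.E T s m ω) l₂ h₂; μ]| ≤ c ∧
    ∑ s : Fin T, ∑ l₂, ∑ h₂,
      |cov[fun ω => unfold k (D.E T t m ω) i j * unfold k (D.E T t m ω) l₁ h₁,
        fun ω => unfold k (D.E T s m ω) i j * unfold k (D.E T s m ω) l₂ h₂; μ]| ≤ c ∧
    ∑ s : Fin T, ∑ l₂, ∑ h₂,
      |cov[fun ω => unfold k (D.E T t m ω) l₁ j * unfold k (D.E T t m ω) i h₁,
        fun ω => unfold k (D.E T s m ω) l₂ j * unfold k (D.E T s m ω) i h₂; μ]| ≤ c)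

end Model

/-- Every entry of the covariance matrix of `T^{-1/2} ∑_t Y_t ⊗ Z_t` is at most `c` in absolute
value. -/
def CrossVarBounded {Ω ι κ : Type*} [MeasurableSpace Ω] (μ : Measure Ω) (T : ℕ)
    (Y : Fin T → Ω → ι → ℝ) (Z : Fin T → Ω → κ → ℝ) (c : ℝ) : Prop :=
  ∀ i j i' j',
    |cov[fun ω => (√(T : ℝ))⁻¹ * ∑ t, Y t ω i * Z t ω j,
      fun ω => (√(T : ℝ))⁻¹ * ∑ t, Y t ω i' * Z t ω j'; μ]| ≤ c

namespace Model

variable {Ω : Type*} [MeasurableSpace Ω] {M : ℕ} {K : Fin M → ℕ} {r u : ∀ m, Fin (K m) → ℕ}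

/-- Dependence across threads: the noise of a thread is uncorrelated with the observations and
with the noise of every other thread, and the sample cross moments have bounded variances. -/
def AcrossThreads (D : Model Ω M K r u) (μ : Measure Ω) : Prop :=
  (∀ T t m n, n ≠ m →
    (∀ i j, cov[fun ω => D.X T t m ω i, fun ω => D.E T t n ω j; μ] = 0) ∧
    (∀ i j, cov[fun ω => D.E T t m ω i, fun ω => D.E T t n ω j; μ] = 0)) ∧
  (∀ m n, n ≠ m → ∃ c : ℝ, ∀ T,
    CrossVarBounded μ T (fun t => D.X T t m) (fun t => D.E T t n) c ∧
    CrossVarBounded μ T (fun t => D.E T t m) (fun t => D.E T t n) c ∧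
    CrossVarBounded μ T (fun t => D.G T t m) (fun t => D.F T t n) c ∧
    CrossVarBounded μ T (fun t => D.F T t m) (fun t => D.F T t n) c ∧
    CrossVarBounded μ T (fun t => D.G T t m) (fun t => D.G T t n) c)

/-- The index sets `S T n ω`, `n ≠ m`, are random variables that are (jointly) independent of the
whole collection of observations, and with probability tending to one not all of them are
empty. -/
def RandomSubsets (D : Model Ω M K r u) (μ : Measure Ω) (m : Fin M)
    (S : ∀ T, Ω → ∀ n : {n : Fin M // n ≠ m}, Finset (MIdx (D.p T n))) : Prop :=
  (∀ T, ∀ s, MeasurableSet {ω | S T ω = s}) ∧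
  (∀ T, Indep (MeasurableSpace.comap (S T) ⊤)
    (MeasurableSpace.comap (fun ω t n i => D.X T t n ω i) inferInstance) μ) ∧
  Tendsto (fun T => μ {ω | ∀ n, S T ω n = ∅}) atTop (𝓝 0)

/-- For every `n ≠ m`, all `r_n = ∏_k r_{n,k}` singular values of the row-restricted Kronecker
product of the loadings are of exact order `|S_n|^{1/2}` in probability. -/
def SubsetRank (D : Model Ω M K r u) (μ : Measure Ω) (m : Fin M)
    (S : ∀ T, Ω → ∀ n : {n : Fin M // n ≠ m}, Finset (MIdx (D.p T n))) : Prop :=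
  ∀ n : {n : Fin M // n ≠ m}, ∀ ε : ℝ, 0 < ε → ∃ a b : ℝ, 0 < a ∧ ∀ᶠ T in atTop,
    μ {ω | ¬ ∀ j < ∏ k, r n k,
      a * √((S T ω n).card : ℝ) ≤ singVal (D.kronRows T n (S T ω n)) j ∧
      singVal (D.kronRows T n (S T ω n)) j ≤ b * √((S T ω n).card : ℝ)} ≤ ENNReal.ofReal ε

end Model

end MultiOrderTFM

end

/-! Distinct threads are correlated only through their global factors. Expanding the sample cross
moment of threads `m` and `n`, every term containing noise or a local factor has mean zero, so the
mean of each `OmegaHat` is `A_{m,k}` times a matrix (`unfold_crossMean`). Hence all mean moment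
matrices have their columns in the space spanned by the global loading, and only the random
deviations move the leading eigenvectors out of it.

Deviations: loadings are bounded and factor numbers fixed, so each entry of `OmegaHat` has mean
squared deviation at most `v / T`, whatever the dimensions (`exists_momentBound`). As the index sets
are independent of the data, Markov's inequality can be applied for each fixed value of the sets;
the squared Frobenius errors, summed over all chosen indices, are then of order `p_m |S| / T`
(`measure_momentError_le`), where `|S|` is the total number of indices.

Signal: Assumption 3(c), used with the loadings of thread `n` divided by the square roots of their
dimensions, bounds the global cross moments from below. The rank condition on the selected rows
contributes a factor `|S_n|`, and the loadings of thread `m` contribute `p_m`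
(`exists_signal_bound`). The signal is thus at least of order `p_m |S|`.

Perturbation: the squared distance of the eigenvectors from the true column space is at most a
constant times error over signal (`leadingEigenvectors_perturbation`). Dimensions and `|S|` cancel,
leaving `1 / T`. Finally, a polar decomposition turns closeness of column spaces into closeness of
the matrices up to an orthogonal factor (`exists_rotation`). -/

namespace MultiOrderTFM

/-! ### Quadratic forms, singular values and inverse square roots -/

section LinearAlgebra

open Matrix

variable {ι κ : Type*} [Fintype ι] [Fintype κ]

lemma norm_sq_toLp (x : ι → ℝ) : ‖WithLp.toLp 2 x‖ ^ 2 = x ⬝ᵥ x := by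
  rw [EuclideanSpace.real_norm_sq_eq]
  simp [dotProduct, sq]

lemma dotProduct_self_nonneg' (x : ι → ℝ) : 0 ≤ x ⬝ᵥ x :=
  Finset.sum_nonneg fun i _ => mul_self_nonneg (x i)

lemma inner_toLp (x y : ι → ℝ) :
    inner ℝ (WithLp.toLp 2 x) (WithLp.toLp 2 y) = x ⬝ᵥ y := by
  simp [PiLp.inner_apply, dotProduct, mul_comm]

lemma mulVec_dotProduct_mulVec (Y : Matrix ι κ ℝ) (x : κ → ℝ) (y : ι → ℝ) :
    (Y *ᵥ x) ⬝ᵥ y = x ⬝ᵥ (Yᵀ *ᵥ y) := by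
  rw [dotProduct_comm, dotProduct_mulVec, ← mulVec_transpose, dotProduct_comm]

lemma sq_dotProduct_le (x y : ι → ℝ) : (x ⬝ᵥ y) ^ 2 ≤ (x ⬝ᵥ x) * (y ⬝ᵥ y) := by
  have := Finset.sum_mul_sq_le_sq_mul_sq Finset.univ x y
  simpa [dotProduct, sq] using this

lemma frobSq_nonneg (Y : Matrix ι κ ℝ) : 0 ≤ frobSq Y :=
  Finset.sum_nonneg fun _ _ => Finset.sum_nonneg fun _ _ => sq_nonneg _

lemma frobSq_transpose (Y : Matrix ι κ ℝ) : frobSq Yᵀ = frobSq Y := by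
  simp only [frobSq, transpose_apply]
  exact Finset.sum_comm

lemma frobSq_eq_trace (Y : Matrix ι κ ℝ) : frobSq Y = (Yᵀ * Y).trace := by
  simp only [frobSq, trace, diag, mul_apply, transpose_apply]
  rw [Finset.sum_comm]
  simp [sq]

lemma frobSq_smul (c : ℝ) (Y : Matrix ι κ ℝ) : frobSq (c • Y) = c ^ 2 * frobSq Y := by
  simp [frobSq, Finset.mul_sum, mul_pow]

lemma mulVec_sq_le_frobSq (Y : Matrix ι κ ℝ) (x : κ → ℝ) :
    (Y *ᵥ x) ⬝ᵥ (Y *ᵥ x) ≤ frobSq Y * (x ⬝ᵥ x) := by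
  simp only [frobSq, Finset.sum_mul]
  refine Finset.sum_le_sum fun i _ => ?_
  have := sq_dotProduct_le (Y i) x
  have h : (Y *ᵥ x) i = Y i ⬝ᵥ x := rfl
  rw [h, ← sq, ← Finset.sum_mul]
  simpa [dotProduct, sq] using this

/-- The difference of the two sides is half of the squared norm of `x + 2 y`. Used to keep half of
the signal when an error is added. -/
lemma add_sq_lower (x y : ι → ℝ) :
    (1 / 2) * (x ⬝ᵥ x) - y ⬝ᵥ y ≤ (x + y) ⬝ᵥ (x + y) := by
  simp only [dotProduct, Finset.mul_sum, ← Finset.sum_sub_distrib, Pi.add_apply]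
  exact Finset.sum_le_sum fun i _ => by nlinarith [sq_nonneg (x i + 2 * y i)]

/-- A quadratic form in terms of an orthonormal eigenbasis. -/
lemma inner_eq_sum_eigenbasis {E : Type*} [NormedAddCommGroup E] [InnerProductSpace ℝ E]
    (b : OrthonormalBasis ι ℝ E) (L : E →ₗ[ℝ] E) (ev : ι → ℝ)
    (h : ∀ i, L (b i) = ev i • b i) (x : E) :
    inner ℝ (L x) x = ∑ i, ev i * (inner ℝ (b i) x) ^ 2 := by
  conv_lhs => rw [← b.sum_repr x]
  rw [map_sum, sum_inner]
  refine Finset.sum_congr rfl fun i _ => ?_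
  rw [map_smul, h, b.sum_repr, inner_smul_left, inner_smul_left, b.repr_apply_apply]
  simp
  ring

lemma toEuclideanLin_adjoint_toLp [DecidableEq ι] [DecidableEq κ] (Y : Matrix ι κ ℝ) (z : ι → ℝ) :
    LinearMap.adjoint (toEuclideanLin Y) (WithLp.toLp 2 z) = WithLp.toLp 2 (Yᵀ *ᵥ z) := by
  rw [← Matrix.toEuclideanLin_conjTranspose_eq_adjoint]
  simp [toLpLin_toLp]

/-- The right singular basis of a matrix. -/
lemma exists_singular_basis [DecidableEq κ] (Y : Matrix ι κ ℝ) :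
    ∃ b : OrthonormalBasis (Fin (Fintype.card κ)) ℝ (EuclideanSpace ℝ κ),
      (∀ x, ‖toEuclideanLin Y x‖ ^ 2 = ∑ j : Fin (Fintype.card κ), singVal Y j ^ 2 * (inner ℝ (b j) x) ^ 2) ∧
      ∀ i j, inner ℝ (toEuclideanLin Y (b i)) (toEuclideanLin Y (b j)) =
        if i = j then singVal Y j ^ 2 else 0 := by
  set L := toEuclideanLin Y with hL
  have hn : Module.finrank ℝ (EuclideanSpace ℝ κ) = Fintype.card κ := by simp
  have hS := L.isSymmetric_adjoint_comp_self
  have heig : ∀ j, (LinearMap.adjoint L ∘ₗ L) (hS.eigenvectorBasis hn j) =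
      (singVal Y j ^ 2) • hS.eigenvectorBasis hn j := by
    intro j
    rw [hS.apply_eigenvectorBasis, singVal, ← hL, L.sq_singularValues_fin hn]
    rfl
  refine ⟨hS.eigenvectorBasis hn, fun x => ?_, fun i j => ?_⟩
  · rw [← inner_eq_sum_eigenbasis _ _ _ heig, LinearMap.comp_apply, LinearMap.adjoint_inner_left,
      real_inner_self_eq_norm_sq]
  · rw [← LinearMap.adjoint_inner_right, ← LinearMap.comp_apply, heig, inner_smul_right,
      (hS.eigenvectorBasis hn).inner_eq_ite]
    split_ifs <;> simp

lemma singVal_nonneg [DecidableEq κ] (Y : Matrix ι κ ℝ) (j : ℕ) : 0 ≤ singVal Y j :=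
  LinearMap.singularValues_nonneg _ _

lemma mulVec_sq_ge_of_singVal [DecidableEq κ] (Y : Matrix ι κ ℝ) {c : ℝ} (hc : 0 ≤ c)
    (h : ∀ j < Fintype.card κ, c ≤ singVal Y j) (x : κ → ℝ) :
    c ^ 2 * (x ⬝ᵥ x) ≤ (Y *ᵥ x) ⬝ᵥ (Y *ᵥ x) := by
  obtain ⟨b, hb, -⟩ := exists_singular_basis Y
  have h1 := hb (WithLp.toLp 2 x)
  rw [toLpLin_toLp, norm_sq_toLp] at h1
  rw [toLin'_apply] at h1
  rw [h1, ← norm_sq_toLp, ← b.sum_sq_norm_inner_right, Finset.mul_sum]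
  refine Finset.sum_le_sum fun j _ => ?_
  rw [Real.norm_eq_abs, sq_abs]
  exact mul_le_mul_of_nonneg_right (pow_le_pow_left₀ hc (h j j.2) 2) (sq_nonneg _)

/-- The witness is a right singular vector. Two-sided bounds on the quadratic form thereby pass to
each singular value without a min-max argument. -/
lemma exists_singVal_sq_eq [DecidableEq κ] (Y : Matrix ι κ ℝ) {j : ℕ} (hj : j < Fintype.card κ) :
    ∃ x : κ → ℝ, x ⬝ᵥ x = 1 ∧ singVal Y j ^ 2 = (Y *ᵥ x) ⬝ᵥ (Y *ᵥ x) := by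
  obtain ⟨b, -, hb⟩ := exists_singular_basis Y
  have h1 := hb ⟨j, hj⟩ ⟨j, hj⟩
  have h2 : b ⟨j, hj⟩ = WithLp.toLp 2 (b ⟨j, hj⟩).ofLp := rfl
  refine ⟨(b ⟨j, hj⟩).ofLp, ?_, ?_⟩
  · rw [← norm_sq_toLp, ← h2]; simp
  · rw [h2, toLpLin_toLp, inner_toLp, if_pos rfl, toLin'_apply] at h1
    exact h1.symm

/-- If the leading singular values, as many as there are rows, are bounded below then the
transpose is bounded below. -/
lemma transpose_mulVec_sq_ge_of_singVal [DecidableEq ι] [DecidableEq κ] (Y : Matrix ι κ ℝ) {c : ℝ}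
    (hc : 0 < c) (h : ∀ j < Fintype.card ι, c ≤ singVal Y j) (z : ι → ℝ) :
    c ^ 2 * (z ⬝ᵥ z) ≤ (Yᵀ *ᵥ z) ⬝ᵥ (Yᵀ *ᵥ z) := by
  -- With fewer columns than rows, the singular value just past the last column would be zero yet at
  -- least `c > 0`.
  have hcard : Fintype.card ι ≤ Fintype.card κ := by
    by_contra! hlt
    have h0 : singVal Y (Fintype.card κ) = 0 :=
      LinearMap.singularValues_of_finrank_le _ (by simp)
    linarith [h _ hlt]
  obtain ⟨b, -, hb⟩ := exists_singular_basis Y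
  set L := toEuclideanLin Y with hL
  let e : Fin (Fintype.card ι) → Fin (Fintype.card κ) := Fin.castLE hcard
  have hpos : ∀ j : Fin (Fintype.card ι), 0 < singVal Y j := fun j => hc.trans_le (h j j.2)
  -- The left singular vectors: orthonormal, and as many as there are rows, hence a basis in which
  -- `z` can be expanded.
  let f : Fin (Fintype.card ι) → EuclideanSpace ℝ ι := fun j => (singVal Y j)⁻¹ • L (b (e j))
  have hf : Orthonormal ℝ f := by
    rw [orthonormal_iff_ite]
    intro i j
    simp only [f, inner_smul_left, inner_smul_right, hb]
    by_cases hij : i = j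
    · subst hij
      have := (hpos i).ne'
      simp [e]
      field_simp
    · have : e i ≠ e j := fun h => hij (Fin.castLE_injective hcard h)
      simp [hij, this]
  have hspan : ⊤ ≤ Submodule.span ℝ (Set.range f) :=
    (hf.linearIndependent.span_eq_top_of_card_eq_finrank' (by simp)).ge
  let B := OrthonormalBasis.mk hf hspan
  have hB := B.sum_sq_norm_inner_right (WithLp.toLp 2 z)
  rw [norm_sq_toLp] at hB
  have hle : ∑ j : Fin (Fintype.card ι),
      ‖inner ℝ (b (e j)) (WithLp.toLp 2 (Yᵀ *ᵥ z))‖ ^ 2 ≤ (Yᵀ *ᵥ z) ⬝ᵥ (Yᵀ *ᵥ z) := by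
    rw [← norm_sq_toLp]
    exact (b.orthonormal.comp e (Fin.castLE_injective hcard)).sum_inner_products_le _
  refine le_trans ?_ hle
  rw [← hB, Finset.mul_sum]
  refine Finset.sum_le_sum fun j _ => ?_
  have h3 : inner ℝ (B j) (WithLp.toLp 2 z) =
      (singVal Y j)⁻¹ * inner ℝ (b (e j)) (WithLp.toLp 2 (Yᵀ *ᵥ z)) := by
    rw [OrthonormalBasis.coe_mk, ← toEuclideanLin_adjoint_toLp, LinearMap.adjoint_inner_right]
    simp [f, inner_smul_left, hL]
  rw [h3]
  simp only [Real.norm_eq_abs, sq_abs]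
  rw [mul_pow, ← mul_assoc]
  refine mul_le_of_le_one_left (sq_nonneg _) ?_
  rw [← mul_pow]
  have := h j j.2
  have h4 : c * (singVal Y j)⁻¹ ≤ 1 := by
    rw [mul_inv_le_iff₀ (hpos j)]; linarith
  exact pow_le_one₀ (mul_nonneg hc.le (inv_nonneg.2 (hpos j).le)) h4

/-- Inverse square root of a positive definite matrix. -/
lemma exists_inv_sqrt [DecidableEq ι] (B : Matrix ι ι ℝ) (hB : Bᵀ = B)
    (hpos : ∀ x, x ≠ 0 → 0 < x ⬝ᵥ (B *ᵥ x)) :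
    ∃ C : Matrix ι ι ℝ, Cᵀ = C ∧ C * B * C = 1 ∧
      ((∀ x, x ⬝ᵥ (B *ᵥ x) ≤ x ⬝ᵥ x) → B.trace ≤ (B * C).trace) := by
  have hH : B.IsHermitian := by rw [IsHermitian, conjTranspose_eq_transpose_of_trivial, hB]
  set W : Matrix ι ι ℝ := hH.eigenvectorUnitary.1 with hW
  set d := hH.eigenvalues with hd
  have hWW : Wᵀ * W = 1 := by
    have := Unitary.coe_star_mul_self hH.eigenvectorUnitary
    rwa [star_eq_conjTranspose, conjTranspose_eq_transpose_of_trivial] at this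
  have hWW' : W * Wᵀ = 1 := mul_eq_one_comm.1 hWW
  have hBW : B = W * diagonal d * Wᵀ := by
    have := hH.spectral_theorem
    rw [Unitary.conjStarAlgAut_apply, star_eq_conjTranspose,
      conjTranspose_eq_transpose_of_trivial] at this
    exact this
  have hdiag : Wᵀ * B * W = diagonal d := by
    rw [hBW]
    calc Wᵀ * (W * diagonal d * Wᵀ) * W = (Wᵀ * W) * diagonal d * (Wᵀ * W) := by
          simp only [Matrix.mul_assoc]
      _ = _ := by simp [hWW]
  have hdq : ∀ i, d i = Wᵀ i ⬝ᵥ (B *ᵥ Wᵀ i) := by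
    intro i
    have := congrFun (congrFun hdiag i) i
    rw [diagonal_apply_eq, Matrix.mul_assoc] at this
    rw [← this]; rfl
  have hw1 : ∀ i, Wᵀ i ⬝ᵥ Wᵀ i = 1 := fun i => by
    have := congrFun (congrFun hWW i) i
    rw [one_apply_eq] at this
    exact this
  have hdpos : ∀ i, 0 < d i := fun i => by
    rw [hdq]
    refine hpos _ fun h0 => ?_
    have := hw1 i
    rw [h0] at this
    simp at this
  refine ⟨W * diagonal (fun i => (√(d i))⁻¹) * Wᵀ, ?_, ?_, fun hle => ?_⟩
  · simp [transpose_mul, Matrix.mul_assoc]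
  · rw [hBW]
    calc W * diagonal (fun i => (√(d i))⁻¹) * Wᵀ * (W * diagonal d * Wᵀ) *
          (W * diagonal (fun i => (√(d i))⁻¹) * Wᵀ)
        = W * (diagonal (fun i => (√(d i))⁻¹) * (Wᵀ * W) * diagonal d * (Wᵀ * W) *
          diagonal (fun i => (√(d i))⁻¹)) * Wᵀ := by simp only [Matrix.mul_assoc]
      _ = W * 1 * Wᵀ := by
          have hone : (fun i => (√(d i))⁻¹ * d i * (√(d i))⁻¹) = fun _ => (1 : ℝ) := by
            ext i
            have h1 := Real.mul_self_sqrt (hdpos i).le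
            have h2 := (Real.sqrt_pos.2 (hdpos i)).ne'
            field_simp
            rw [sq, h1]
          rw [hWW]
          simp only [Matrix.mul_one, diagonal_mul_diagonal, hone, diagonal_one]
      _ = 1 := by simp [hWW']
  · have h1 : (B * (W * diagonal (fun i => (√(d i))⁻¹) * Wᵀ)).trace =
        ∑ i, d i * (√(d i))⁻¹ := by
      rw [← Matrix.mul_assoc, trace_mul_comm, ← Matrix.mul_assoc, ← Matrix.mul_assoc, hdiag,
        diagonal_mul_diagonal, trace_diagonal]
    have h2 : B.trace = ∑ i, d i := by
      have : B.trace = (Wᵀ * B * W).trace := by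
        rw [trace_mul_comm, ← Matrix.mul_assoc, hWW', Matrix.one_mul]
      rw [this, hdiag, trace_diagonal]
    rw [h1, h2]
    refine Finset.sum_le_sum fun i _ => ?_
    -- Here the traces are sums of `d i` and of `√(d i)`, and `d ≤ √d` on `[0, 1]`.
    have h3 : d i ≤ 1 := by rw [hdq, ← hw1 i]; exact hle _
    have h4 : √(d i) ≤ 1 := Real.sqrt_le_one.2 h3
    exact le_mul_of_one_le_right (hdpos i).le
      ((one_le_inv₀ (Real.sqrt_pos.2 (hdpos i))).2 h4)

end LinearAlgebra

/-! ### Perturbation of leading eigenvectors -/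

section Perturbation

open Matrix

/-- Leading eigenvectors in matrix form; the eigenvalues are bounded below by any lower bound of
the quadratic form on the column space of an injective matrix. -/
lemma IsLeadingEigenvectors.exists_eigenvalues {p r : ℕ} {Y : Matrix (Fin p) (Fin p) ℝ}
    {V : Matrix (Fin p) (Fin r) ℝ} (h : IsLeadingEigenvectors Y V) :
    ∃ ev : Fin r → ℝ, Vᵀ * V = 1 ∧ (∀ j, Y *ᵥ (Vᵀ j) = ev j • Vᵀ j) ∧
      ∀ (U : Matrix (Fin p) (Fin r) ℝ) (L : ℝ), (∀ x, x ≠ 0 → U *ᵥ x ≠ 0) →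
        (∀ x, L * ((U *ᵥ x) ⬝ᵥ (U *ᵥ x)) ≤ (Y *ᵥ (U *ᵥ x)) ⬝ᵥ (U *ᵥ x)) → ∀ j, L ≤ ev j := by
  obtain ⟨hrp, b, ev, hanti, heig, hV⟩ := h
  have hcol : ∀ j, WithLp.toLp 2 (Vᵀ j) = b (Fin.castLE hrp j) := fun j => by
    ext i; simp [hV]
  refine ⟨fun j => ev (Fin.castLE hrp j), ?_, fun j => ?_, fun U L hU hL j => ?_⟩
  · ext i j
    have h1 : (Vᵀ * V) i j = inner ℝ (b (Fin.castLE hrp i)) (b (Fin.castLE hrp j)) := by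
      rw [← hcol, ← hcol, inner_toLp]; rfl
    rw [h1, b.inner_eq_ite, one_apply]
    simp
  · have := heig (Fin.castLE hrp j)
    rw [← hcol, toLpLin_toLp, toLin'_apply] at this
    exact congrArg WithLp.ofLp this
  · -- a nonzero vector in the range of `U`, orthogonal to the first `j` eigenvectors
    let φ : (Fin r → ℝ) →ₗ[ℝ] (Fin j → ℝ) :=
      (Matrix.of fun (i : Fin j) => Vᵀ (Fin.castLE j.2.le i)).mulVecLin ∘ₗ U.mulVecLin
    -- Courant–Fischer by counting: `j < r` linear conditions on `r` coordinates leave a nonzero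
    -- solution.
    have hker : 0 < Module.finrank ℝ (LinearMap.ker φ) := by
      have h1 := φ.finrank_range_add_finrank_ker
      have h2 := Submodule.finrank_le (LinearMap.range φ)
      simp only [Module.finrank_fin_fun] at h1 h2
      have := j.2
      omega
    have : Nontrivial (LinearMap.ker φ) := Module.finrank_pos_iff.1 hker
    obtain ⟨⟨x, hx⟩, hx0⟩ := exists_ne (0 : LinearMap.ker φ)
    have hx0 : x ≠ 0 := fun h => hx0 (Subtype.ext h)
    set v := U *ᵥ x with hv
    have horth : ∀ i : Fin p, i < Fin.castLE hrp j → inner ℝ (b i) (WithLp.toLp 2 v) = 0 := by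
      intro i hi
      have hi' : (i : ℕ) < j := hi
      have h1 := congrFun (LinearMap.mem_ker.1 hx) ⟨i, hi'⟩
      have h2 : b i = WithLp.toLp 2 (Vᵀ ⟨i, hi'.trans j.2⟩) := by
        rw [hcol]; rfl
      rw [h2, inner_toLp]
      exact h1
    have h1 := inner_eq_sum_eigenbasis b (toEuclideanLin Y) ev heig (WithLp.toLp 2 v)
    rw [toLpLin_toLp, inner_toLp, toLin'_apply] at h1
    have h2 := b.sum_sq_norm_inner_right (WithLp.toLp 2 v)
    rw [norm_sq_toLp] at h2
    -- Only components along eigenvectors of index at least `j` survive, and their eigenvalues are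
    -- at most the `j`th.
    have h3 : (Y *ᵥ v) ⬝ᵥ v ≤ ev (Fin.castLE hrp j) * (v ⬝ᵥ v) := by
      rw [h1, ← h2, Finset.mul_sum]
      refine Finset.sum_le_sum fun i _ => ?_
      rw [Real.norm_eq_abs, sq_abs]
      rcases lt_or_ge i (Fin.castLE hrp j) with hi | hi
      · simp [horth i hi]
      · exact mul_le_mul_of_nonneg_right (hanti hi) (sq_nonneg _)
    have hvpos : 0 < v ⬝ᵥ v := by
      refine lt_of_le_of_ne (dotProduct_self_nonneg' v) fun h0 => hU x hx0 ?_
      exact dotProduct_self_eq_zero.1 h0.symm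
    exact le_of_mul_le_mul_right ((hL x).trans h3) hvpos

/-- Two matrices with orthonormal columns whose column spaces are close agree up to an orthogonal
matrix and a small error. -/
lemma exists_rotation {p r : ℕ} (U V : Matrix (Fin p) (Fin r) ℝ) (hU : Uᵀ * U = 1)
    (hV : Vᵀ * V = 1) {δ : ℝ} (hδ : frobSq (V - U * (Uᵀ * V)) ≤ δ) (hδ1 : δ < 1) :
    ∃ O : Matrix (Fin r) (Fin r) ℝ, Oᵀ * O = 1 ∧ frobSq (V - U * O) ≤ 2 * δ := by
  set N := Uᵀ * V with hN
  have hE : (V - U * N)ᵀ * (V - U * N) = 1 - Nᵀ * N := by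
    have h1 : Vᵀ * (U * N) = Nᵀ * N := by
      rw [← Matrix.mul_assoc, hN, transpose_mul, transpose_transpose]
    have h2 : (U * N)ᵀ * (U * N) = Nᵀ * N := by
      rw [transpose_mul, Matrix.mul_assoc, ← Matrix.mul_assoc Uᵀ, hU, Matrix.one_mul]
    have h3 : (U * N)ᵀ * V = Nᵀ * N := by
      rw [transpose_mul, Matrix.mul_assoc, ← hN]
    rw [transpose_sub, Matrix.sub_mul, Matrix.mul_sub, Matrix.mul_sub, hV, h1, h2, h3]
    abel
  have hquad : ∀ x, x ⬝ᵥ ((Nᵀ * N) *ᵥ x) =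
      x ⬝ᵥ x - ((V - U * N) *ᵥ x) ⬝ᵥ ((V - U * N) *ᵥ x) := by
    intro x
    rw [mulVec_dotProduct_mulVec, mulVec_mulVec, hE, sub_mulVec, one_mulVec, dotProduct_sub]
    ring
  -- `NᵀN` is the identity minus the Gram matrix of the residual, so `δ < 1` makes it positive
  -- definite.
  obtain ⟨C, hCt, hC, htr⟩ := exists_inv_sqrt (Nᵀ * N) (by simp [transpose_mul]) (by
    intro x hx
    rw [hquad]
    have h1 := mulVec_sq_le_frobSq (V - U * N) x
    have h2 : 0 < x ⬝ᵥ x :=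
      lt_of_le_of_ne (dotProduct_self_nonneg' x) fun h0 => hx (dotProduct_self_eq_zero.1 h0.symm)
    nlinarith)
  have htr := htr (fun x => by rw [hquad]; linarith [dotProduct_self_nonneg' ((V - U * N) *ᵥ x)])
  have hO : (N * C)ᵀ * (N * C) = 1 := by
    rw [transpose_mul, hCt, ← hC]; simp only [Matrix.mul_assoc]
  -- The orthogonal polar factor of `N`. Its error is `2 (r - tr √(NᵀN))`, while the residual has
  -- squared norm `r - tr NᵀN`; the trace inequality compares the two.
  refine ⟨N * C, hO, ?_⟩
  have h1 : frobSq (V - U * N) = (1 - Nᵀ * N).trace := by rw [frobSq_eq_trace, hE]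
  have h2 : frobSq (V - U * (N * C)) = 2 * ((1 : Matrix (Fin r) (Fin r) ℝ).trace -
      (Nᵀ * N * C).trace) := by
    have e1 : Vᵀ * (U * (N * C)) = Nᵀ * N * C := by
      rw [← Matrix.mul_assoc, ← Matrix.mul_assoc, hN, transpose_mul, transpose_transpose]
    have e2 : (U * (N * C))ᵀ * (U * (N * C)) = 1 := by
      rw [transpose_mul, Matrix.mul_assoc, ← Matrix.mul_assoc Uᵀ, hU, Matrix.one_mul, hO]
    have e3 : ((U * (N * C))ᵀ * V).trace = (Nᵀ * N * C).trace := by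
      rw [← trace_transpose, transpose_mul, transpose_transpose, e1]
    rw [frobSq_eq_trace, transpose_sub, Matrix.sub_mul, Matrix.mul_sub, Matrix.mul_sub, hV, e1, e2,
      trace_sub, trace_sub, trace_sub, e3]
    ring
  rw [trace_sub] at h1
  rw [h2]
  linarith

/-- Perturbation of the leading eigenvectors of `∑ O_i O_iᵀ` when `O_i` is, up to the error `R_i`,
a matrix with columns in the column space of `U`. -/
lemma leadingEigenvectors_perturbation {p r : ℕ} {ι κ : Type*} [Fintype κ] (s : Finset ι)
    (O R : ι → Matrix (Fin p) κ ℝ) (N : ι → Matrix (Fin r) κ ℝ) (U V : Matrix (Fin p) (Fin r) ℝ)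
    (hU : Uᵀ * U = 1) (hO : ∀ i, O i = U * N i + R i)
    (hV : IsLeadingEigenvectors (∑ i ∈ s, O i * (O i)ᵀ) V) {L e : ℝ} (hL : 0 < L) (heL : e ≤ L)
    (hR : ∑ i ∈ s, frobSq (R i) ≤ e)
    (hN : ∀ x, 4 * L * (x ⬝ᵥ x) ≤ ∑ i ∈ s, ((N i)ᵀ *ᵥ x) ⬝ᵥ ((N i)ᵀ *ᵥ x)) :
    Vᵀ * V = 1 ∧ frobSq (V - U * (Uᵀ * V)) ≤ r * (e / L) := by
  obtain ⟨ev, hVV, heig, hev⟩ := hV.exists_eigenvalues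
  refine ⟨hVV, ?_⟩
  have hUx : ∀ x, (U *ᵥ x) ⬝ᵥ (U *ᵥ x) = x ⬝ᵥ x := fun x => by
    rw [mulVec_dotProduct_mulVec, mulVec_mulVec, hU, one_mulVec]
  have hquad : ∀ v, ((∑ i ∈ s, O i * (O i)ᵀ) *ᵥ v) ⬝ᵥ v =
      ∑ i ∈ s, ((O i)ᵀ *ᵥ v) ⬝ᵥ ((O i)ᵀ *ᵥ v) := fun v => by
    rw [sum_mulVec, sum_dotProduct]
    refine Finset.sum_congr rfl fun i _ => ?_
    rw [← mulVec_mulVec, mulVec_dotProduct_mulVec]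
  -- On the range of `U`, half of the signal `4 L` survives and the error costs at most `e ≤ L`,
  -- which leaves `L`.
  have hLev : ∀ j, L ≤ ev j := by
    refine hev U L (fun x hx h0 => hx ?_) fun x => ?_
    · have := hUx x
      rw [h0] at this
      exact dotProduct_self_eq_zero.1 (by rw [← this]; simp)
    · rw [hquad, hUx]
      have h1 : ∀ i ∈ s, (1 / 2) * (((N i)ᵀ *ᵥ x) ⬝ᵥ ((N i)ᵀ *ᵥ x)) - frobSq (R i) * (x ⬝ᵥ x) ≤
          ((O i)ᵀ *ᵥ (U *ᵥ x)) ⬝ᵥ ((O i)ᵀ *ᵥ (U *ᵥ x)) := fun i _ => by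
        have h2 : (O i)ᵀ *ᵥ (U *ᵥ x) = (N i)ᵀ *ᵥ x + (R i)ᵀ *ᵥ (U *ᵥ x) := by
          rw [hO, transpose_add, add_mulVec, transpose_mul, mulVec_mulVec, Matrix.mul_assoc, hU,
            Matrix.mul_one]
        have h3 := mulVec_sq_le_frobSq (R i)ᵀ (U *ᵥ x)
        rw [frobSq_transpose, hUx] at h3
        rw [h2]
        linarith [add_sq_lower ((N i)ᵀ *ᵥ x) ((R i)ᵀ *ᵥ (U *ᵥ x))]
      refine le_trans ?_ (Finset.sum_le_sum h1)
      rw [Finset.sum_sub_distrib, ← Finset.mul_sum, ← Finset.sum_mul]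
      have hx := dotProduct_self_nonneg' x
      nlinarith [hN x, mul_le_mul_of_nonneg_right (hR.trans heL) hx]
  -- the complement of the column space of `U`
  set P : Matrix (Fin p) (Fin p) ℝ := 1 - U * Uᵀ with hP
  have hPU : P * U = 0 := by
    rw [hP, Matrix.sub_mul, Matrix.mul_assoc, hU]; simp
  have hPPt : Pᵀ * P = P := by
    have : Pᵀ = P := by simp [hP, transpose_sub, transpose_mul]
    rw [this]
    nth_rw 2 [hP]
    rw [Matrix.mul_sub, ← Matrix.mul_assoc, hPU]; simp
  have hcolj : ∀ j, (P *ᵥ Vᵀ j) ⬝ᵥ (P *ᵥ Vᵀ j) ≤ e / L := by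
    intro j
    set v := Vᵀ j with hv
    have hv1 : v ⬝ᵥ v = 1 := by
      have := congrFun (congrFun hVV j) j
      rw [one_apply_eq] at this
      exact this
    have hevpos : 0 < ev j := hL.trans_le (hLev j)
    have hsum : ∑ i ∈ s, ((O i)ᵀ *ᵥ v) ⬝ᵥ ((O i)ᵀ *ᵥ v) = ev j := by
      rw [← hquad, heig, smul_dotProduct, hv1, smul_eq_mul, mul_one]
    set w := P *ᵥ v with hw
    -- `P` annihilates `U`, so projecting the eigenvector equation replaces the left factor `O i` by
    -- the error `R i`.
    have h1 : ev j * (w ⬝ᵥ w) = ∑ i ∈ s, ((R i)ᵀ *ᵥ w) ⬝ᵥ ((O i)ᵀ *ᵥ v) := by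
      have h2 : ev j • w = ∑ i ∈ s, P *ᵥ (R i *ᵥ ((O i)ᵀ *ᵥ v)) := by
        rw [hw, ← mulVec_smul, ← heig, sum_mulVec, mulVec_sum]
        refine Finset.sum_congr rfl fun i _ => ?_
        have hPO : P * O i = P * R i := by
          rw [hO, Matrix.mul_add, ← Matrix.mul_assoc, hPU, Matrix.zero_mul, zero_add]
        rw [mulVec_mulVec, ← Matrix.mul_assoc, hPO, Matrix.mul_assoc, ← mulVec_mulVec,
          ← mulVec_mulVec]
      have hPw : Pᵀ *ᵥ w = w := by
        rw [hw, mulVec_mulVec, hPPt]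
      rw [← smul_eq_mul, ← smul_dotProduct, h2, sum_dotProduct]
      refine Finset.sum_congr rfl fun i _ => ?_
      rw [mulVec_dotProduct_mulVec, hPw, mulVec_dotProduct_mulVec, dotProduct_comm]
    have hww := dotProduct_self_nonneg' w
    -- Cauchy–Schwarz over the whole family. The factor with `O i` sums exactly to `ev j`, so
    -- cancelling `ev j * (w ⬝ᵥ w)` gives a bound linear in `e / ev j`, with no product of error and
    -- signal sizes.
    have h3 : (ev j * (w ⬝ᵥ w)) ^ 2 ≤ (e * (w ⬝ᵥ w)) * ev j := by
      have hcs : (ev j * (w ⬝ᵥ w)) ^ 2 ≤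
          (∑ i ∈ s, ((R i)ᵀ *ᵥ w) ⬝ᵥ ((R i)ᵀ *ᵥ w)) *
            ∑ i ∈ s, ((O i)ᵀ *ᵥ v) ⬝ᵥ ((O i)ᵀ *ᵥ v) := by
        rw [h1]
        simp only [dotProduct, ← Finset.sum_product', ← sq]
        exact Finset.sum_mul_sq_le_sq_mul_sq _ _ _
      refine hcs.trans ?_
      rw [hsum]
      refine mul_le_mul_of_nonneg_right ?_ hevpos.le
      calc ∑ i ∈ s, ((R i)ᵀ *ᵥ w) ⬝ᵥ ((R i)ᵀ *ᵥ w)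
          ≤ ∑ i ∈ s, frobSq (R i) * (w ⬝ᵥ w) := Finset.sum_le_sum fun i _ => by
            simpa [frobSq_transpose] using mulVec_sq_le_frobSq (R i)ᵀ w
        _ = (∑ i ∈ s, frobSq (R i)) * (w ⬝ᵥ w) := by rw [Finset.sum_mul]
        _ ≤ _ := mul_le_mul_of_nonneg_right hR hww
    rw [le_div_iff₀ hL]
    have he0 : 0 ≤ e := (Finset.sum_nonneg fun i _ => frobSq_nonneg (R i)).trans hR
    rcases hww.eq_or_lt with h0 | hpos
    · rw [← h0]; simpa using he0
    · have h4 : (w ⬝ᵥ w) * ev j ≤ e := by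
        have h5 : 0 < ev j * (w ⬝ᵥ w) := mul_pos hevpos hpos
        refine le_of_mul_le_mul_right ?_ h5
        nlinarith
      exact (mul_le_mul_of_nonneg_left (hLev j) hww).trans h4
  have hfin : frobSq (V - U * (Uᵀ * V)) = ∑ j, (P *ᵥ Vᵀ j) ⬝ᵥ (P *ᵥ Vᵀ j) := by
    have h1 : V - U * (Uᵀ * V) = P * V := by
      rw [hP, Matrix.sub_mul, Matrix.one_mul, Matrix.mul_assoc]
    rw [h1, ← frobSq_transpose]
    refine Finset.sum_congr rfl fun j _ => ?_
    simp only [dotProduct, sq]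
    rfl
  rw [hfin]
  calc ∑ j, (P *ᵥ Vᵀ j) ⬝ᵥ (P *ᵥ Vᵀ j) ≤ ∑ _j : Fin r, e / L :=
        Finset.sum_le_sum fun j _ => hcolj j
    _ = r * (e / L) := by simp

end Perturbation

/-! ### Kronecker products over an arbitrary finite set of modes -/

section Kronecker

open Matrix

/-- The Kronecker product of a finite family of matrices. -/
noncomputable def piKron {ι : Type*} [Fintype ι] {α β : ι → Type*} (A : ∀ j, Matrix (α j) (β j) ℝ) :
    Matrix (∀ j, α j) (∀ j, β j) ℝ :=
  Matrix.of fun i c => ∏ j, A j (i j) (c j)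

variable {ι : Type*} [Fintype ι] {α β γ : ι → Type*}

lemma piKron_mul [DecidableEq ι] [∀ j, Fintype (β j)] (A : ∀ j, Matrix (α j) (β j) ℝ) (B : ∀ j, Matrix (β j) (γ j) ℝ) :
    piKron A * piKron B = piKron fun j => A j * B j := by
  ext i c
  simp only [piKron, mul_apply, of_apply]
  rw [Finset.prod_univ_sum, Fintype.piFinset_univ]
  simp only [Finset.prod_mul_distrib]

lemma piKron_one [∀ j, DecidableEq (α j)] :
    piKron (fun j => (1 : Matrix (α j) (α j) ℝ)) = 1 := by
  ext i c
  simp only [piKron, of_apply, one_apply]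
  by_cases h : i = c
  · simp [h]
  · obtain ⟨j, hj⟩ := Function.ne_iff.1 h
    rw [if_neg h]
    exact Finset.prod_eq_zero (Finset.mem_univ j) (by simp [hj])

lemma frobSq_piKron [DecidableEq ι] [∀ j, Fintype (α j)] [∀ j, Fintype (β j)]
    (A : ∀ j, Matrix (α j) (β j) ℝ) :
    frobSq (piKron A) = ∏ j, frobSq (A j) := by
  simp only [frobSq, piKron, of_apply]
  rw [Finset.prod_univ_sum, Fintype.piFinset_univ]
  refine Finset.sum_congr rfl fun i _ => ?_
  rw [Finset.prod_univ_sum, Fintype.piFinset_univ]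
  simp only [Finset.prod_pow]

/-- The Kronecker product of left inverses is a left inverse, and its squared Frobenius norm is the
product of theirs. -/
lemma le_piKron_mulVec_sq [DecidableEq ι] [∀ j, Fintype (α j)] [∀ j, Fintype (β j)]
    [∀ j, DecidableEq (β j)] (A : ∀ j, Matrix (α j) (β j) ℝ)
    (L : ∀ j, Matrix (β j) (α j) ℝ) (hL : ∀ j, L j * A j = 1) (x : (∀ j, β j) → ℝ) :
    x ⬝ᵥ x ≤ (∏ j, frobSq (L j)) * ((piKron A *ᵥ x) ⬝ᵥ (piKron A *ᵥ x)) := by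
  have h1 : piKron L *ᵥ (piKron A *ᵥ x) = x := by
    rw [mulVec_mulVec, piKron_mul]
    simp only [hL, piKron_one, one_mulVec]
  have h2 := mulVec_sq_le_frobSq (piKron L) (piKron A *ᵥ x)
  rwa [h1, frobSq_piKron] at h2

end Kronecker

/-! ### Unfoldings of multi-mode products -/

section Unfolding

open Matrix

variable {K : ℕ} {p r : Fin K → ℕ}

/-- Splitting a multi-index into its `k`th entry and the rest factors the Kronecker product. This is
what puts the loading of mode `k` alone on the left. -/
lemma unfold_mulVec_kron (k : Fin K) (A : ∀ k, Matrix (Fin (p k)) (Fin (r k)) ℝ) (Y : Tensor r) :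
    unfold k ((kron A).mulVec Y) =
      A k * unfold k Y * (piKron fun j : {j : Fin K // j ≠ k} => A j)ᵀ := by
  ext i l
  simp only [unfold, of_apply, mulVec, dotProduct, mul_apply, transpose_apply, kron, piKron]
  rw [← (Equiv.piSplitAt k (fun j => Fin (r j))).symm.sum_comp, Fintype.sum_prod_type,
    Finset.sum_comm]
  refine Finset.sum_congr rfl fun c _ => ?_
  rw [Finset.sum_mul]
  refine Finset.sum_congr rfl fun a _ => ?_
  rw [Fintype.prod_eq_mul_prod_subtype_ne _ k]
  have h : ∀ j : {j : Fin K // j ≠ k}, (j : Fin K) ≠ k := fun j => j.2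
  simp [Equiv.piSplitAt, h]
  ring

lemma frobSq_unfold (k : Fin K) (Y : Tensor p) : frobSq (unfold k Y) = ∑ i, Y i ^ 2 := by
  rw [← (Equiv.piSplitAt k (fun j => Fin (p j))).symm.sum_comp, Fintype.sum_prod_type]
  rfl

end Unfolding

/-! ### Well-conditioned loadings and the strength of the signal -/

section Loadings

open Matrix

/-- Symmetric orthonormalization of the columns of a matrix that is bounded below. -/
lemma exists_orthonormalization {ι κ : Type*} [Fintype ι] [Fintype κ] [DecidableEq κ]
    (A : Matrix ι κ ℝ) {α : ℝ} (hα : 0 < α)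
    (hA : ∀ x, α * (x ⬝ᵥ x) ≤ (A *ᵥ x) ⬝ᵥ (A *ᵥ x)) :
    ∃ C : Matrix κ κ ℝ, Cᵀ = C ∧ C * (Aᵀ * A) * C = 1 := by
  obtain ⟨C, h1, h2, -⟩ := exists_inv_sqrt (Aᵀ * A) (by simp [transpose_mul]) fun x hx => by
    rw [← mulVec_mulVec, ← mulVec_dotProduct_mulVec]
    have : 0 < x ⬝ᵥ x :=
      lt_of_le_of_ne (dotProduct_self_nonneg' x) fun h0 => hx (dotProduct_self_eq_zero.1 h0.symm)
    exact (mul_pos hα this).trans_le (hA x)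
  exact ⟨C, h1, h2⟩

/-- With `C` the inverse square root of `AᵀA`, the pseudo-inverse `C C Aᵀ` has the Frobenius norm of
`C`; each column of `C` is mapped by `A` to a unit vector, hence has squared norm at most `1 / α`.
-/
lemma exists_leftInverse {ι κ : Type*} [Fintype ι] [Fintype κ] [DecidableEq κ]
    (A : Matrix ι κ ℝ) {α : ℝ} (hα : 0 < α)
    (hA : ∀ x, α * (x ⬝ᵥ x) ≤ (A *ᵥ x) ⬝ᵥ (A *ᵥ x)) :
    ∃ L : Matrix κ ι ℝ, L * A = 1 ∧ frobSq L ≤ Fintype.card κ / α := by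
  obtain ⟨C, hCt, hC⟩ := exists_orthonormalization A hα hA
  refine ⟨C * (C * Aᵀ), ?_, ?_⟩
  · rw [Matrix.mul_assoc, Matrix.mul_assoc]
    exact mul_eq_one_comm.1 hC
  · have h1 : frobSq (C * (C * Aᵀ)) = frobSq C := by
      rw [← frobSq_transpose, frobSq_eq_trace, frobSq_eq_trace, transpose_transpose]
      congr 1
      rw [transpose_mul, transpose_mul, transpose_transpose, hCt]
      calc C * (C * Aᵀ) * (A * C * C) = C * (C * (Aᵀ * A) * C) * C := by
            simp only [Matrix.mul_assoc]
        _ = C * C := by rw [hC, Matrix.mul_one]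
    have h2 : ∀ j, α * (Cᵀ j ⬝ᵥ Cᵀ j) ≤ 1 := fun j => by
      refine (hA _).trans (le_of_eq ?_)
      have h3 : (A * C)ᵀ * (A * C) = 1 := by
        rw [transpose_mul, hCt, ← hC]; simp only [Matrix.mul_assoc]
      have := congrFun (congrFun h3 j) j
      rw [one_apply_eq] at this
      exact this
    have h4 : frobSq C = ∑ j, Cᵀ j ⬝ᵥ Cᵀ j := by
      rw [← frobSq_transpose]
      simp [frobSq, dotProduct, sq]
    rw [h1, h4, le_div_iff₀ hα, mul_comm, Finset.mul_sum]
    refine (Finset.sum_le_sum fun j _ => h2 j).trans (by simp)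

/-- The signal in the moment matrices indexed by `s`, along the direction `z`. -/
lemma signal_lower_bound {r : ℕ} {ι κ β γ τ : Type*} [Fintype κ] [Fintype β] [Fintype γ]
    [Fintype τ] (s : Finset ι) (B : Matrix ι β ℝ) (Γ : β → Matrix (Fin r) γ ℝ) (Q : Matrix κ γ ℝ)
    (W : Matrix τ β ℝ) (F : Matrix (Fin r) (γ × τ) ℝ)
    (hF : ∀ i c l, F i (c, l) = ∑ b, W l b * Γ b i c) {fQ a fW c : ℝ} (ha : 0 ≤ a) (hfW : 0 ≤ fW) (hQ : ∀ y, y ⬝ᵥ y ≤ fQ * ((Q *ᵥ y) ⬝ᵥ (Q *ᵥ y)))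
    (hB : ∀ y, a * (y ⬝ᵥ y) ≤ ∑ i ∈ s, (B *ᵥ y) i ^ 2) (hW : frobSq W ≤ fW)
    (z : Fin r → ℝ) (hFz : c * (z ⬝ᵥ z) ≤ (Fᵀ *ᵥ z) ⬝ᵥ (Fᵀ *ᵥ z)) :
    c * a * (z ⬝ᵥ z) ≤ fW * fQ * ∑ i ∈ s, (Q *ᵥ ((∑ b, B i b • Γ b)ᵀ *ᵥ z)) ⬝ᵥ
      (Q *ᵥ ((∑ b, B i b • Γ b)ᵀ *ᵥ z)) := by
  -- Both `Fᵀ z` and the signal are linear images of these vectors: through `W` and through the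
  -- selected rows of `B`, the latter followed by `Q`. A lower bound for the first thus passes to
  -- the second.
  let y : γ → β → ℝ := fun c b => ∑ i, Γ b i c * z i
  have h1 : (Fᵀ *ᵥ z) ⬝ᵥ (Fᵀ *ᵥ z) = ∑ c, (W *ᵥ y c) ⬝ᵥ (W *ᵥ y c) := by
    have h2 : ∀ c l, (Fᵀ *ᵥ z) (c, l) = (W *ᵥ y c) l := fun c l => by
      simp only [mulVec, dotProduct, transpose_apply, hF, y, Finset.sum_mul, Finset.mul_sum]
      rw [Finset.sum_comm]
      simp only [mul_assoc]
    simp only [dotProduct, Fintype.sum_prod_type, h2]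
  have h3 : ∀ i c, ((∑ b, B i b • Γ b)ᵀ *ᵥ z) c = (B *ᵥ y c) i := fun i c => by
    simp only [mulVec, dotProduct, transpose_apply, Matrix.sum_apply, Matrix.smul_apply, smul_eq_mul, y,
      Finset.sum_mul, Finset.mul_sum]
    rw [Finset.sum_comm]
    simp only [mul_assoc]
  have hW' : c * (z ⬝ᵥ z) ≤ fW * ∑ c, y c ⬝ᵥ y c := by
    refine hFz.trans ?_
    rw [h1, Finset.mul_sum]
    exact Finset.sum_le_sum fun c _ => (mulVec_sq_le_frobSq _ _).trans
      (mul_le_mul_of_nonneg_right hW (dotProduct_self_nonneg' _))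
  have hB' : a * ∑ c, y c ⬝ᵥ y c ≤
      ∑ i ∈ s, ((∑ b, B i b • Γ b)ᵀ *ᵥ z) ⬝ᵥ ((∑ b, B i b • Γ b)ᵀ *ᵥ z) := by
    rw [Finset.mul_sum]
    refine (Finset.sum_le_sum fun c _ => hB (y c)).trans (le_of_eq ?_)
    rw [Finset.sum_comm]
    refine Finset.sum_congr rfl fun i _ => ?_
    simp only [dotProduct, h3, sq]
  have hQ' : ∑ i ∈ s, ((∑ b, B i b • Γ b)ᵀ *ᵥ z) ⬝ᵥ ((∑ b, B i b • Γ b)ᵀ *ᵥ z) ≤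
      fQ * ∑ i ∈ s, (Q *ᵥ ((∑ b, B i b • Γ b)ᵀ *ᵥ z)) ⬝ᵥ
        (Q *ᵥ ((∑ b, B i b • Γ b)ᵀ *ᵥ z)) := by
    rw [Finset.mul_sum]
    exact Finset.sum_le_sum fun i _ => hQ _
  calc c * a * (z ⬝ᵥ z) = a * (c * (z ⬝ᵥ z)) := by ring
    _ ≤ a * (fW * ∑ c, y c ⬝ᵥ y c) := mul_le_mul_of_nonneg_left hW' ha
    _ = fW * (a * ∑ c, y c ⬝ᵥ y c) := by ring
    _ ≤ _ := by
      rw [mul_assoc]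
      exact mul_le_mul_of_nonneg_left (hB'.trans hQ') hfW

/-- Padding `x` by zeros in the local block restricts the error of the joint Gram matrix to the
global loading. -/
lemma gram_sub_one_quadForm {ι κ ν : Type*} [Fintype ι] [Fintype κ] [Fintype ν] [DecidableEq κ]
    [DecidableEq ν] (A : Matrix ι κ ℝ) (B : Matrix ι ν ℝ) {q ρ : ℝ} (hq : 0 < q)
    (h : specNorm (q⁻¹ • ((fromCols A B)ᵀ * fromCols A B) - 1) ≤ ρ) (x : κ → ℝ) :
    (1 - ρ) * q * (x ⬝ᵥ x) ≤ (A *ᵥ x) ⬝ᵥ (A *ᵥ x) ∧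
      (A *ᵥ x) ⬝ᵥ (A *ᵥ x) ≤ (1 + ρ) * q * (x ⬝ᵥ x) := by
  set Z := q⁻¹ • ((fromCols A B)ᵀ * fromCols A B) - 1 with hZ
  let w : κ ⊕ ν → ℝ := Sum.elim x 0
  have hw : w ⬝ᵥ w = x ⬝ᵥ x := by simp [w, dotProduct]
  have hAw : fromCols A B *ᵥ w = A *ᵥ x := by
    simp [w, fromCols_mulVec]
  have h1 : w ⬝ᵥ (Z *ᵥ w) = q⁻¹ * ((A *ᵥ x) ⬝ᵥ (A *ᵥ x)) - x ⬝ᵥ x := by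
    rw [hZ, sub_mulVec, dotProduct_sub, one_mulVec, hw, smul_mulVec, dotProduct_smul,
      ← mulVec_mulVec, ← mulVec_dotProduct_mulVec, hAw, smul_eq_mul]
  have h2 : |w ⬝ᵥ (Z *ᵥ w)| ≤ ρ * (x ⬝ᵥ x) := by
    have h3 : w ⬝ᵥ (Z *ᵥ w) =
        inner ℝ (WithLp.toLp 2 w) (toEuclideanCLM (n := κ ⊕ ν) (𝕜 := ℝ) Z (WithLp.toLp 2 w)) := by
      rw [toEuclideanCLM_toLp, inner_toLp]
    rw [h3, ← hw, ← norm_sq_toLp]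
    refine (abs_real_inner_le_norm _ _).trans ?_
    have h4 := (toEuclideanCLM (n := κ ⊕ ν) (𝕜 := ℝ) Z).le_of_opNorm_le h (WithLp.toLp 2 w)
    nlinarith [norm_nonneg (WithLp.toLp 2 w)]
  rw [h1, abs_le] at h2
  have h5 : q * (q⁻¹ * ((A *ᵥ x) ⬝ᵥ (A *ᵥ x))) = (A *ᵥ x) ⬝ᵥ (A *ᵥ x) := by
    field_simp
  constructor
  · rw [← h5]; nlinarith
  · rw [← h5]; nlinarith

end Loadings

/-! ### Means and variances of sample cross moments -/

section Moments

variable {Ω : Type*} [MeasurableSpace Ω] {μ : Measure Ω}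

/-- `f` is square integrable with mean `e` and variance at most `v`. -/
structure MomentBound (μ : Measure Ω) (f : Ω → ℝ) (e v : ℝ) : Prop where
  memLp : MemLp f 2 μ
  mean : ∫ ω, f ω ∂μ = e
  var_le : ∫ ω, (f ω - e) ^ 2 ∂μ ≤ v

namespace MomentBound

lemma integrable_sq [IsFiniteMeasure μ] {f : Ω → ℝ} {e v : ℝ} (h : MomentBound μ f e v) :
    Integrable (fun ω => (f ω - e) ^ 2) μ :=
  (h.memLp.sub (memLp_const e)).integrable_sq

lemma add [IsFiniteMeasure μ] {f g : Ω → ℝ} {e v e' v' : ℝ} (hf : MomentBound μ f e v)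
    (hg : MomentBound μ g e' v') :
    MomentBound μ (fun ω => f ω + g ω) (e + e') (2 * (v + v')) := by
  refine ⟨hf.memLp.add hg.memLp, ?_, ?_⟩
  · rw [integral_add (hf.memLp.integrable one_le_two) (hg.memLp.integrable one_le_two), hf.mean,
      hg.mean]
  · have h1 : ∫ ω, (f ω + g ω - (e + e')) ^ 2 ∂μ ≤
        ∫ ω, (2 * (f ω - e) ^ 2 + 2 * (g ω - e') ^ 2) ∂μ := by
      refine integral_mono_of_nonneg (Eventually.of_forall fun ω => sq_nonneg _)
        ((hf.integrable_sq.const_mul 2).add (hg.integrable_sq.const_mul 2))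
        (Eventually.of_forall fun ω => ?_)
      simp only
      nlinarith [sq_nonneg ((f ω - e) - (g ω - e'))]
    rw [integral_add (hf.integrable_sq.const_mul 2) (hg.integrable_sq.const_mul 2),
      integral_const_mul, integral_const_mul] at h1
    linarith [hf.var_le, hg.var_le]

lemma const_mul {f : Ω → ℝ} {e v : ℝ} (hf : MomentBound μ f e v) (c : ℝ) :
    MomentBound μ (fun ω => c * f ω) (c * e) (c ^ 2 * v) := by
  refine ⟨hf.memLp.const_mul c, ?_, ?_⟩
  · rw [integral_const_mul, hf.mean]
  · simp only [← mul_sub, mul_pow]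
    rw [integral_const_mul]
    exact mul_le_mul_of_nonneg_left hf.var_le (sq_nonneg c)

lemma mono {f : Ω → ℝ} {e v v' : ℝ} (hf : MomentBound μ f e v) (h : v ≤ v') :
    MomentBound μ f e v' :=
  ⟨hf.memLp, hf.mean, hf.var_le.trans h⟩

lemma sum [IsFiniteMeasure μ] {α : Type*} [Fintype α] {f : α → Ω → ℝ} {e : α → ℝ} {v : ℝ}
    (hf : ∀ a, MomentBound μ (f a) (e a) v) :
    MomentBound μ (fun ω => ∑ a, f a ω) (∑ a, e a) ((Fintype.card α : ℝ) ^ 2 * v) := by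
  refine ⟨memLp_finsetSum _ fun a _ => (hf a).memLp, ?_, ?_⟩
  · rw [integral_finsetSum _ fun a _ => (hf a).memLp.integrable one_le_two]
    exact Finset.sum_congr rfl fun a _ => (hf a).mean
  · have h1 : ∫ ω, (∑ a, f a ω - ∑ a, e a) ^ 2 ∂μ ≤
        ∫ ω, (Fintype.card α : ℝ) * ∑ a, (f a ω - e a) ^ 2 ∂μ := by
      refine integral_mono_of_nonneg (Eventually.of_forall fun ω => sq_nonneg _)
        ((integrable_finsetSum _ fun a _ => (hf a).integrable_sq).const_mul _)
        (Eventually.of_forall fun ω => ?_)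
      simp only [← Finset.sum_sub_distrib]
      exact sq_sum_le_card_mul_sum_sq
    refine h1.trans ?_
    rw [integral_const_mul, integral_finsetSum _ fun a _ => (hf a).integrable_sq, sq, mul_assoc]
    refine mul_le_mul_of_nonneg_left ?_ (Nat.cast_nonneg _)
    refine (Finset.sum_le_sum fun a _ => (hf a).var_le).trans (by simp)

/-- Sample cross moments of linear combinations of random variables. -/
lemma bilinear [IsFiniteMeasure μ] {T : ℕ} {α β : Type*} [Fintype α] [Fintype β]
    {Y : Fin T → Ω → α → ℝ} {Z : Fin T → Ω → β → ℝ} {e : α → β → ℝ} {v : ℝ} (hv : 0 ≤ v)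
    (h : ∀ a b, MomentBound μ (fun ω => (T : ℝ)⁻¹ * ∑ t, Y t ω a * Z t ω b) (e a b) v)
    (x : α → ℝ) (y : β → ℝ) {c d : ℝ} (hx : ∀ a, |x a| ≤ c) (hy : ∀ b, |y b| ≤ d) :
    MomentBound μ
      (fun ω => (T : ℝ)⁻¹ * ∑ t, (∑ a, x a * Y t ω a) * (∑ b, y b * Z t ω b))
      (∑ a, ∑ b, x a * y b * e a b)
      ((Fintype.card (α × β) : ℝ) ^ 2 * ((c * d) ^ 2 * v)) := by
  have h1 : ∀ q : α × β, MomentBound μ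
      (fun ω => (x q.1 * y q.2) * ((T : ℝ)⁻¹ * ∑ t, Y t ω q.1 * Z t ω q.2))
      (x q.1 * y q.2 * e q.1 q.2) ((c * d) ^ 2 * v) := fun q => by
    refine ((h q.1 q.2).const_mul _).mono (mul_le_mul_of_nonneg_right ?_ hv)
    rw [← sq_abs, abs_mul]
    have := hx q.1
    have := hy q.2
    have := abs_nonneg (x q.1)
    exact pow_le_pow_left₀ (by positivity)
      (mul_le_mul (hx _) (hy _) (abs_nonneg _) (by linarith)) 2
  have h2 := MomentBound.sum h1
  rw [Fintype.sum_prod_type] at h2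
  convert h2 using 1
  ext ω
  rw [Fintype.sum_prod_type]
  simp only [Finset.sum_mul_sum]
  simp only [Finset.mul_sum]
  rw [Finset.sum_comm]
  refine Finset.sum_congr rfl fun a _ => ?_
  rw [Finset.sum_comm]
  exact Finset.sum_congr rfl fun b _ => Finset.sum_congr rfl fun t _ => by ring

end MomentBound

lemma memLp_mul_of_four [IsFiniteMeasure μ] {Y Z : Ω → ℝ} (hY : MemLp Y 4 μ) (hZ : MemLp Z 4 μ) :
    MemLp (fun ω => Y ω * Z ω) 2 μ := by
  have : ENNReal.HolderTriple 4 4 2 := ⟨by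
    have h : (4 : ENNReal) = 2 * 2 := by norm_num
    rw [h, ENNReal.mul_inv (by simp) (by simp), ← mul_add, ENNReal.inv_two_add_inv_two, mul_one]⟩
  exact hZ.mul hY

lemma integral_mul_eq_zero_of_cov [IsProbabilityMeasure μ] {Y Z : Ω → ℝ} (hY : MemLp Y 4 μ)
    (hZ : MemLp Z 4 μ) (hcov : cov[Y, Z; μ] = 0) (hZ0 : ∫ ω, Z ω ∂μ = 0) :
    ∫ ω, Y ω * Z ω ∂μ = 0 := by
  have h24 : (2 : ENNReal) ≤ 4 := by norm_num
  have h1 := covariance_eq_sub (hY.mono_exponent h24) (hZ.mono_exponent h24)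
  rw [hcov, hZ0, mul_zero, sub_zero] at h1
  exact h1.symm

/-- Mean and variance of a sample cross moment. -/
lemma CrossVarBounded.momentBound [IsProbabilityMeasure μ] {T : ℕ} {ι κ : Type*}
    {Y : Fin T → Ω → ι → ℝ} {Z : Fin T → Ω → κ → ℝ} {c : ℝ} (h : CrossVarBounded μ T Y Z c)
    (hT : 0 < T) {i : ι} {j : κ} (hY : ∀ t, MemLp (fun ω => Y t ω i) 4 μ)
    (hZ : ∀ t, MemLp (fun ω => Z t ω j) 4 μ) :
    MomentBound μ (fun ω => (T : ℝ)⁻¹ * ∑ t, Y t ω i * Z t ω j)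
      ((T : ℝ)⁻¹ * ∑ t, ∫ ω, Y t ω i * Z t ω j ∂μ) (c / T) := by
  have hL : ∀ t, MemLp (fun ω => Y t ω i * Z t ω j) 2 μ := fun t => memLp_mul_of_four (hY t) (hZ t)
  have hsum : MemLp (fun ω => ∑ t, Y t ω i * Z t ω j) 2 μ := memLp_finsetSum _ fun t _ => hL t
  have hmean : ∫ ω, ∑ t, Y t ω i * Z t ω j ∂μ = ∑ t, ∫ ω, Y t ω i * Z t ω j ∂μ :=
    integral_finsetSum _ fun t _ => (hL t).integrable one_le_two
  refine ⟨hsum.const_mul _, ?_, ?_⟩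
  · rw [integral_const_mul, hmean]
  · have h1 := h i j i j
    rw [covariance_self (hsum.const_mul _).aemeasurable,
      variance_eq_integral (hsum.const_mul _).aemeasurable] at h1
    have h2 := (le_abs_self _).trans h1
    simp only [integral_const_mul, hmean, ← mul_sub, mul_pow] at h2 ⊢
    have hT' : (0 : ℝ) < T := by exact_mod_cast hT
    rw [inv_pow, Real.sq_sqrt hT'.le] at h2
    rw [le_div_iff₀ hT']
    refine le_trans (le_of_eq ?_) h2
    field_simp

end Moments

/-! ### Markov's inequality over an independent random index set -/

section RandomIndex

variable {Ω : Type*} [MeasurableSpace Ω] {μ : Measure Ω}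

lemma measure_sum_gt_le [IsProbabilityMeasure μ] {ι : Type*} (s : Finset ι) {f : ι → Ω → ℝ}
    (hf : ∀ i, 0 ≤ f i) (hint : ∀ i, Integrable (f i) μ) {v K : ℝ} (hv : 0 < v) (hK : 0 < K)
    (hle : ∀ i, ∫ ω, f i ω ∂μ ≤ v) :
    μ {ω | K * v * s.card < ∑ i ∈ s, f i ω} ≤ ENNReal.ofReal K⁻¹ := by
  -- For empty `s` the strict inequality reads `0 < 0`.
  rcases s.eq_empty_or_nonempty with rfl | hs
  · simp
  have hpos : 0 < K * v * s.card := mul_pos (mul_pos hK hv) (by exact_mod_cast hs.card_pos)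
  have h1 := mul_meas_ge_le_integral_of_nonneg (μ := μ) (f := fun ω => ∑ i ∈ s, f i ω)
    (Eventually.of_forall fun ω => Finset.sum_nonneg fun i _ => hf i ω)
    (integrable_finsetSum _ fun i _ => hint i) (K * v * s.card)
  rw [integral_finsetSum _ fun i _ => hint i] at h1
  have h2 : ∑ i ∈ s, ∫ ω, f i ω ∂μ ≤ s.card * v :=
    (Finset.sum_le_sum fun i _ => hle i).trans (by simp)
  refine (measure_mono (t := {ω | K * v * s.card ≤ ∑ i ∈ s, f i ω}) fun ω hω => by
    simp only [Set.mem_ofPred_eq] at hω ⊢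
    exact hω.le).trans ?_
  refine (ENNReal.le_ofReal_iff_toReal_le (measure_ne_top _ _) (by positivity)).2 ?_
  rw [← one_div, le_div_iff₀ hK]
  have h3 : (s.card * v) * (μ.real {ω | K * v * s.card ≤ ∑ i ∈ s, f i ω} * K) ≤
      (s.card * v) * 1 := by
    calc _ = K * v * s.card * μ.real {ω | K * v * s.card ≤ ∑ i ∈ s, f i ω} := by ring
      _ ≤ _ := h1.trans (h2.trans (by simp))
  exact le_of_mul_le_mul_left h3 (mul_pos (by exact_mod_cast hs.card_pos) hv)

/-- Markov's inequality for a sum over a random index set independent of the summands. -/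
lemma measure_random_sum_gt_le [IsProbabilityMeasure μ] {σ ι 𝒳 : Type*} [Fintype σ]
    [MeasurableSpace 𝒳] (S : Ω → σ) (hS : ∀ s, MeasurableSet {ω | S ω = s}) {X : Ω → 𝒳}
    (hind : Indep (MeasurableSpace.comap S ⊤) (MeasurableSpace.comap X inferInstance) μ)
    (idx : σ → Finset ι) {g : ι → 𝒳 → ℝ} (hg : ∀ i, Measurable (g i)) (hg0 : ∀ i, 0 ≤ g i)
    {v K : ℝ} (hv : 0 < v) (hK : 0 < K) (hint : ∀ i, Integrable (fun ω => g i (X ω)) μ)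
    (hle : ∀ i, ∫ ω, g i (X ω) ∂μ ≤ v) :
    μ {ω | K * v * (idx (S ω)).card < ∑ i ∈ idx (S ω), g i (X ω)} ≤ ENNReal.ofReal K⁻¹ := by
  let W : σ → Set Ω := fun s => {ω | K * v * (idx s).card < ∑ i ∈ idx s, g i (X ω)}
  -- Split by the value of `S`: independence factors each piece, and the Markov bound is the same
  -- for every value.
  have hsub : {ω | K * v * (idx (S ω)).card < ∑ i ∈ idx (S ω), g i (X ω)} ⊆
      ⋃ s ∈ (Finset.univ : Finset σ), {ω | S ω = s} ∩ W s := fun ω hω => by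
    simp only [Set.mem_iUnion]
    exact ⟨S ω, Finset.mem_univ _, rfl, hω⟩
  have hprod : ∀ s, μ ({ω | S ω = s} ∩ W s) = μ {ω | S ω = s} * μ (W s) := fun s => by
    refine (Indep_iff _ _ μ).1 hind _ _ ⟨{s}, trivial, rfl⟩ ?_
    refine ⟨{x | K * v * (idx s).card < ∑ i ∈ idx s, g i x}, ?_, rfl⟩
    exact measurableSet_lt measurable_const (Finset.measurable_sum _ fun i _ => hg i)
  have hone : ∑ s : σ, μ {ω | S ω = s} ≤ 1 := by
    have hd : Pairwise (Function.onFun Disjoint fun s => {ω | S ω = s}) := fun s s' hne =>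
      Set.disjoint_left.2 fun ω h h' => hne (h.symm.trans h')
    rw [← measure_biUnion_finset (fun s _ s' _ hne => hd hne) fun s _ => hS s]
    exact prob_le_one
  calc _ ≤ ∑ s : σ, μ ({ω | S ω = s} ∩ W s) :=
        (measure_mono hsub).trans (measure_biUnion_finset_le _ _)
    _ ≤ ∑ s : σ, μ {ω | S ω = s} * ENNReal.ofReal K⁻¹ := Finset.sum_le_sum fun s _ => by
        rw [hprod]
        gcongr
        exact measure_sum_gt_le _ (fun i ω => hg0 i (X ω)) hint hv hK hle
    _ ≤ 1 * ENNReal.ofReal K⁻¹ := by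
        rw [← Finset.sum_mul]
        gcongr
    _ = _ := one_mul _

end RandomIndex
-- Moments of the model across threads
lemma abs_kron_le {K : ℕ} {p r : Fin K → ℕ} (A : ∀ k, Matrix (Fin (p k)) (Fin (r k)) ℝ)
    {c : Fin K → ℝ} (hA : ∀ k i a, |A k i a| ≤ c k) (i : MIdx p) (a : MIdx r) :
    |kron A i a| ≤ ∏ k, c k := by
  simp only [kron, Matrix.of_apply, Finset.abs_prod]
  exact Finset.prod_le_prod (fun _ _ => abs_nonneg _) fun k _ => hA k _ _

namespace Model

variable {Ω : Type*} [MeasurableSpace Ω] {M : ℕ} {K : Fin M → ℕ} {r u : ∀ m, Fin (K m) → ℕ}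

/-- Average second cross moments `T⁻¹ ∑_t E[G_a^{(m)} G_b^{(n)}]` of the global factors. -/
noncomputable def factorMoment (D : Model Ω M K r u) (μ : Measure Ω) (T : ℕ) (m n : Fin M) (a : MIdx (r m))
    (b : MIdx (r n)) : ℝ :=
  (T : ℝ)⁻¹ * ∑ t : Fin T, ∫ ω, D.G T t m ω a * D.G T t n ω b ∂μ

/-- The mean of the sample cross moments of two threads. -/
noncomputable def crossMean (D : Model Ω M K r u) (μ : Measure Ω) (T : ℕ) (m n : Fin M) (I : MIdx (D.p T m))
    (i : MIdx (D.p T n)) : ℝ :=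
  ∑ a, ∑ b, kron (D.A T m) I a * kron (D.A T n) i b * D.factorMoment μ T m n a b

variable {D : Model Ω M K r u} {μ : Measure Ω}

lemma CoreFactor.memLp_G (h : D.CoreFactor μ) (T : ℕ) (t : Fin T) (m : Fin M) (a : MIdx (r m)) :
    MemLp (fun ω => D.G T t m ω a) 4 μ := by
  obtain ⟨⟨c, hc⟩, -⟩ := h
  exact ((hc T t m).1 a).1

lemma CoreFactor.memLp_F (h : D.CoreFactor μ) (T : ℕ) (t : Fin T) (m : Fin M) (a : MIdx (u m)) :
    MemLp (fun ω => D.F T t m ω a) 4 μ := by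
  obtain ⟨⟨c, hc⟩, -⟩ := h
  exact ((hc T t m).2 a).1

lemma Noise.memLp_E (h : D.Noise μ) (T : ℕ) (t : Fin T) (m : Fin M) (i : MIdx (D.p T m)) :
    MemLp (fun ω => D.E T t m ω i) 4 μ := by
  obtain ⟨⟨c, hc⟩, -⟩ := h
  exact (hc T t m i).2.1

lemma Noise.integral_E (h : D.Noise μ) (T : ℕ) (t : Fin T) (m : Fin M) (i : MIdx (D.p T m)) :
    ∫ ω, D.E T t m ω i ∂μ = 0 := by
  obtain ⟨⟨c, hc⟩, -⟩ := h
  exact (hc T t m i).1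

lemma X_apply (D : Model Ω M K r u) (T : ℕ) (t : Fin T) (m : Fin M) (ω : Ω)
    (i : MIdx (D.p T m)) :
    D.X T t m ω i = ∑ a, kron (D.A T m) i a * D.G T t m ω a +
      ∑ b, kron (D.B T m) i b * D.F T t m ω b + D.E T t m ω i := rfl

lemma memLp_X (hCore : D.CoreFactor μ) (hNoise : D.Noise μ) (T : ℕ) (t : Fin T) (m : Fin M)
    (i : MIdx (D.p T m)) : MemLp (fun ω => D.X T t m ω i) 4 μ := by
  simp only [X_apply]
  exact ((memLp_finsetSum _ fun a _ => (hCore.memLp_G T t m a).const_mul _).add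
    (memLp_finsetSum _ fun a _ => (hCore.memLp_F T t m a).const_mul _)).add
    (hNoise.memLp_E T t m i)

lemma Loadings.exists_kron_bound (h : D.Loadings) (m : Fin M) :
    ∃ c : ℝ, ∀ T, (∀ i a, |kron (D.A T m) i a| ≤ c) ∧ (∀ i b, |kron (D.B T m) i b| ≤ c) := by
  choose c hc using h m
  exact ⟨∏ k, c k, fun T => ⟨abs_kron_le _ fun k => (hc k T).1,
    abs_kron_le _ fun k => (hc k T).2.1⟩⟩

/-- The sample cross moments of different threads have mean `crossMean` and variances of order
`1 / T`. -/
lemma exists_momentBound [IsProbabilityMeasure μ] (hIdent : D.Identification μ)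
    (hLoad : D.Loadings) (hCore : D.CoreFactor μ) (hNoise : D.Noise μ) (hAcross : D.AcrossThreads μ)
    {m n : Fin M} (hnm : n ≠ m) :
    ∃ v : ℝ, ∀ T : ℕ, 0 < T → ∀ I i,
      MomentBound μ (fun ω => (T : ℝ)⁻¹ * ∑ t, D.X T t m ω I * D.X T t n ω i)
        (D.crossMean μ T m n I i) (v / T) := by
  obtain ⟨cm, hcm⟩ := hLoad.exists_kron_bound m
  obtain ⟨cn, hcn⟩ := hLoad.exists_kron_bound n
  obtain ⟨c₁, hc₁⟩ := hAcross.2 m n hnm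
  -- The swapped pair supplies the terms with the noise or the local factor in thread `m`.
  obtain ⟨c₂, hc₂⟩ := hAcross.2 n m hnm.symm
  set c := max 0 (max c₁ c₂) with hc
  have hc0 : 0 ≤ c := le_max_left _ _
  have hc1 : c₁ ≤ c := (le_max_left _ _).trans (le_max_right _ _)
  have hc2 : c₂ ≤ c := (le_max_right _ _).trans (le_max_right _ _)
  let N₁ : ℝ := (Fintype.card (MIdx (r m) × MIdx (r n)) : ℝ) ^ 2 * (cm * cn) ^ 2
  let N₂ : ℝ := (Fintype.card (MIdx (r m) × MIdx (u n)) : ℝ) ^ 2 * (cm * cn) ^ 2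
  let N₃ : ℝ := (Fintype.card (MIdx (u m) × MIdx (r n)) : ℝ) ^ 2 * (cm * cn) ^ 2
  let N₄ : ℝ := (Fintype.card (MIdx (u m) × MIdx (u n)) : ℝ) ^ 2 * (cm * cn) ^ 2
  refine ⟨2 * (c + 2 * (c + 2 * (c + 2 * (N₁ * c + 2 * (N₂ * c + 2 * (N₃ * c + N₄ * c)))))), ?_⟩
  intro T hT I i
  have hT' : (0 : ℝ) < T := by exact_mod_cast hT
  obtain ⟨hXE, hEE, hGF, hFF, hGG⟩ := hc₁ T
  obtain ⟨hXE', -, hGF', -, -⟩ := hc₂ T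
  have hG := hCore.memLp_G T
  have hF := hCore.memLp_F T
  have hE := hNoise.memLp_E T
  have hX := memLp_X hCore hNoise T
  have hv : 0 ≤ c / T := by positivity
  have b₁ : MomentBound μ (fun ω => (T : ℝ)⁻¹ * ∑ t, D.X T t m ω I * D.E T t n ω i) 0 (c / T) := by
    have h := hXE.momentBound hT (fun t => hX t m I) fun t => hE t n i
    rw [Finset.sum_eq_zero fun t _ => integral_mul_eq_zero_of_cov (hX t m I) (hE t n i)
      ((hAcross.1 T t m n hnm).1 I i) (hNoise.integral_E T t n i), mul_zero] at h
    exact h.mono (by gcongr)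
  have b₂ : MomentBound μ (fun ω => (T : ℝ)⁻¹ * ∑ t, D.E T t m ω I * D.X T t n ω i) 0 (c / T) := by
    have h := hXE'.momentBound hT (fun t => hX t n i) fun t => hE t m I
    rw [Finset.sum_eq_zero fun t _ => integral_mul_eq_zero_of_cov (hX t n i) (hE t m I)
      ((hAcross.1 T t n m hnm.symm).1 i I) (hNoise.integral_E T t m I), mul_zero] at h
    simp only [mul_comm (D.E T _ m _ I)]
    exact h.mono (by gcongr)
  have b₃ : MomentBound μ (fun ω => (T : ℝ)⁻¹ * ∑ t, D.E T t m ω I * D.E T t n ω i) 0 (c / T) := by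
    have h := hEE.momentBound hT (fun t => hE t m I) fun t => hE t n i
    rw [Finset.sum_eq_zero fun t _ => integral_mul_eq_zero_of_cov (hE t m I) (hE t n i)
      ((hAcross.1 T t m n hnm).2 I i) (hNoise.integral_E T t n i), mul_zero] at h
    exact h.mono (by gcongr)
  have g₁ : ∀ a b, MomentBound μ (fun ω => (T : ℝ)⁻¹ * ∑ t, D.G T t m ω a * D.G T t n ω b)
      (D.factorMoment μ T m n a b) (c / T) := fun a b =>
    (hGG.momentBound hT (fun t => hG t m a) fun t => hG t n b).mono (by gcongr)
  have g₂ : ∀ a b, MomentBound μ (fun ω => (T : ℝ)⁻¹ * ∑ t, D.G T t m ω a * D.F T t n ω b)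
      0 (c / T) := fun a b => by
    have h := hGF.momentBound hT (fun t => hG t m a) fun t => hF t n b
    rw [Finset.sum_eq_zero fun t _ => integral_mul_eq_zero_of_cov (hG t m a) (hF t n b)
      ((hIdent.2 T t m n hnm).1 a b) ((hIdent.1 T t n).2 b), mul_zero] at h
    exact h.mono (by gcongr)
  have g₃ : ∀ a b, MomentBound μ (fun ω => (T : ℝ)⁻¹ * ∑ t, D.F T t m ω a * D.G T t n ω b)
      0 (c / T) := fun a b => by
    have h := hGF'.momentBound hT (fun t => hG t n b) fun t => hF t m a
    rw [Finset.sum_eq_zero fun t _ => integral_mul_eq_zero_of_cov (hG t n b) (hF t m a)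
      ((hIdent.2 T t n m hnm.symm).1 b a) ((hIdent.1 T t m).2 a), mul_zero] at h
    simp only [mul_comm (D.F T _ m _ a)]
    exact h.mono (by gcongr)
  have g₄ : ∀ a b, MomentBound μ (fun ω => (T : ℝ)⁻¹ * ∑ t, D.F T t m ω a * D.F T t n ω b)
      0 (c / T) := fun a b => by
    have h := hFF.momentBound hT (fun t => hF t m a) fun t => hF t n b
    rw [Finset.sum_eq_zero fun t _ => integral_mul_eq_zero_of_cov (hF t m a) (hF t n b)
      ((hIdent.2 T t m n hnm).2 a b) ((hIdent.1 T t n).2 b), mul_zero] at h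
    exact h.mono (by gcongr)
  have b₄ := MomentBound.bilinear hv g₁ _ _ ((hcm T).1 I) ((hcn T).1 i)
  have b₅ := MomentBound.bilinear hv g₂ _ _ ((hcm T).1 I) ((hcn T).2 i)
  have b₆ := MomentBound.bilinear hv g₃ _ _ ((hcm T).2 I) ((hcn T).1 i)
  have b₇ := MomentBound.bilinear hv g₄ _ _ ((hcm T).2 I) ((hcn T).2 i)
  -- Writing `X = Y + E` in each thread, `X X' = X E' + E X' - E E' + Y Y'`, and `Y Y'` splits into
  -- four products of core factors.
  have htot := b₁.add (b₂.add ((b₃.const_mul (-1)).add (b₄.add (b₅.add (b₆.add b₇)))))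
  convert htot using 1
  · ext ω
    simp only [Finset.mul_sum (s := (Finset.univ : Finset (Fin T)))]
    simp only [← Finset.sum_add_distrib, X_apply]
    exact Finset.sum_congr rfl fun t _ => by ring
  · simp [crossMean]
  · simp only [N₁, N₂, N₃, N₄]
    ring

lemma OmegaHat_eq_unfold (D : Model Ω M K r u) (T : ℕ) (m : Fin M) (k : Fin (K m)) (n : Fin M)
    (i : MIdx (D.p T n)) (ω : Ω) :
    D.OmegaHat T m k n i ω =
      unfold k (fun I => (T : ℝ)⁻¹ * ∑ t, D.X T t m ω I * D.X T t n ω i) := by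
  ext a c
  simp [OmegaHat, unfold, Matrix.sum_apply, mul_comm]

/-- The squared error of the moment matrices is of order `1 / T` on average over a random set of
indices that is independent of the observations. -/
lemma measure_momentError_le [IsProbabilityMeasure μ] {m : Fin M} {v : ℝ} (hv : 0 < v) {T : ℕ}
    (hT : 0 < T)
    (hb : ∀ n, n ≠ m → ∀ I i,
      MomentBound μ (fun ω => (T : ℝ)⁻¹ * ∑ t, D.X T t m ω I * D.X T t n ω i)
        (D.crossMean μ T m n I i) (v / T))
    (S : Ω → ∀ n : {n : Fin M // n ≠ m}, Finset (MIdx (D.p T n)))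
    (hS : ∀ s, MeasurableSet {ω | S ω = s})
    (hind : Indep (MeasurableSpace.comap S ⊤)
      (MeasurableSpace.comap (fun ω t n i => D.X T t n ω i) inferInstance) μ)
    (k : Fin (K m)) {κ : ℝ} (hκ : 0 < κ) :
    μ {ω | κ * ((∏ j, (D.p T m j : ℝ)) * (v / T)) * (Finset.univ.sigma (S ω)).card <
      ∑ q ∈ Finset.univ.sigma (S ω), frobSq (D.OmegaHat T m k q.1 q.2 ω -
        unfold k fun I => D.crossMean μ T m q.1 I q.2)} ≤ ENNReal.ofReal κ⁻¹ := by
  have hT' : (0 : ℝ) < T := by exact_mod_cast hT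
  -- The squared error as a function of the observations alone, so that independence from the index
  -- sets applies.
  let g : (Σ n : {n : Fin M // n ≠ m}, MIdx (D.p T n)) →
      (∀ (_ : Fin T) (n : Fin M), MIdx (D.p T n) → ℝ) → ℝ := fun q x =>
    ∑ I, ((T : ℝ)⁻¹ * ∑ t, x t m I * x t q.1 q.2 - D.crossMean μ T m q.1 I q.2) ^ 2
  have hg : ∀ q, Measurable (g q) := fun q => by
    simp only [g]
    fun_prop
  have hgX : ∀ q ω, frobSq (D.OmegaHat T m k q.1 q.2 ω -
      unfold k fun I => D.crossMean μ T m q.1 I q.2) = g q (fun t n i => D.X T t n ω i) := by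
    intro q ω
    rw [OmegaHat_eq_unfold]
    exact frobSq_unfold k (fun I => (T : ℝ)⁻¹ * ∑ t, D.X T t m ω I * D.X T t q.1 ω q.2 -
      D.crossMean μ T m q.1 I q.2)
  have hp : 0 < ∏ j, (D.p T m j : ℝ) :=
    Finset.prod_pos fun j _ => by exact_mod_cast D.p_pos T m j
  have hmain := measure_random_sum_gt_le (μ := μ) S hS
    (X := fun ω t n i => D.X T t n ω i) hind (fun s => Finset.univ.sigma s) hg
    (fun q x => Finset.sum_nonneg fun I _ => sq_nonneg _)
    (v := (∏ j, (D.p T m j : ℝ)) * (v / T)) (by positivity) hκ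
    (fun q => integrable_finsetSum _ fun I _ => (hb q.1 q.1.2 I q.2).integrable_sq)
    (fun q => by
      simp only [g]
      rw [integral_finsetSum _ fun I _ => (hb q.1 q.1.2 I q.2).integrable_sq]
      refine (Finset.sum_le_sum fun I _ => (hb q.1 q.1.2 I q.2).var_le).trans (le_of_eq ?_)
      simp)
  simpa only [hgX] using hmain

end Model

/-! ### The signal in the mean moment matrices -/

open Matrix in
lemma frobSq_le_of_mulVec_sq_le {ι κ : Type*} [Fintype ι] [Fintype κ] [DecidableEq κ]
    (Y : Matrix ι κ ℝ) {β : ℝ} (h : ∀ x, (Y *ᵥ x) ⬝ᵥ (Y *ᵥ x) ≤ β * (x ⬝ᵥ x)) :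
    frobSq Y ≤ Fintype.card κ * β := by
  have h1 : frobSq Y = ∑ j, (Y *ᵥ Pi.single j 1) ⬝ᵥ (Y *ᵥ Pi.single j 1) := by
    rw [← frobSq_transpose]
    simp [frobSq, dotProduct, sq]
  rw [h1]
  refine (Finset.sum_le_sum fun j _ => h (Pi.single j 1)).trans ?_
  simp

open Matrix in
lemma singVal_mem_of_mulVec_sq {ι κ : Type*} [Fintype ι] [Fintype κ] [DecidableEq κ]
    (Y : Matrix ι κ ℝ) {α β : ℝ}
    (h : ∀ x, α * (x ⬝ᵥ x) ≤ (Y *ᵥ x) ⬝ᵥ (Y *ᵥ x) ∧ (Y *ᵥ x) ⬝ᵥ (Y *ᵥ x) ≤ β * (x ⬝ᵥ x))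
    {j : ℕ} (hj : j < Fintype.card κ) : √α ≤ singVal Y j ∧ singVal Y j ≤ √β := by
  obtain ⟨x, hx, hxY⟩ := exists_singVal_sq_eq Y hj
  obtain ⟨h1, h2⟩ := h x
  rw [hx, mul_one, ← hxY] at h1 h2
  refine ⟨?_, Real.le_sqrt_of_sq_le h2⟩
  rw [← Real.sqrt_sq (singVal_nonneg Y j)]
  exact Real.sqrt_le_sqrt h1

namespace Model

open Matrix

variable {Ω : Type*} [MeasurableSpace Ω] {M : ℕ} {K : Fin M → ℕ} {r u : ∀ m, Fin (K m) → ℕ}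
  {D : Model Ω M K r u} {μ : Measure Ω}

/-- A uniform version of `LoadingsNondegenerate`, in terms of quadratic forms. -/
lemma LoadingsNondegenerate.exists_quadForm (h : D.LoadingsNondegenerate) :
    ∃ ρ : ℝ, 0 ≤ ρ ∧ ρ < 1 ∧ ∀ᶠ T in atTop, ∀ m k x,
      (1 - ρ) * D.p T m k * (x ⬝ᵥ x) ≤ (D.A T m k *ᵥ x) ⬝ᵥ (D.A T m k *ᵥ x) ∧
        (D.A T m k *ᵥ x) ⬝ᵥ (D.A T m k *ᵥ x) ≤ (1 + ρ) * D.p T m k * (x ⬝ᵥ x) := by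
  choose ρ hρ hev using h
  -- Taking the upper bound inside `Set.Iio 1` keeps it strictly below one.
  have : Nonempty (Set.Iio (1 : ℝ)) := ⟨⟨0, by simp⟩⟩
  obtain ⟨⟨ρ', hρ'⟩, hle⟩ :=
    Finite.exists_le fun q : Σ m, Fin (K m) => (⟨ρ q.1 q.2, hρ q.1 q.2⟩ : Set.Iio (1 : ℝ))
  refine ⟨max 0 ρ', le_max_left _ _, max_lt one_pos hρ', ?_⟩
  have hall : ∀ᶠ T in atTop, ∀ m k, D.gramError T m k ≤ ρ m k :=
    eventually_all.2 fun m => eventually_all.2 fun k => hev m k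
  filter_upwards [hall] with T hT m k x
  refine gram_sub_one_quadForm _ (D.B T m k) (by exact_mod_cast D.p_pos T m k) ?_ x
  have h1 : ρ m k ≤ ρ' := hle ⟨m, k⟩
  exact (hT m k).trans (h1.trans (le_max_right _ _))

lemma factorCrossMoment_apply [IsFiniteMeasure μ] (hCore : D.CoreFactor μ) (T : ℕ) (m : Fin M)
    (k : Fin (K m)) (n : Fin M) (L : ∀ h, Matrix (Fin (D.p T n h)) (Fin (r n h)) ℝ)
    (i : Fin (r m k)) (c : CoIdx (r m) k) (l : MIdx (D.p T n)) :
    D.factorCrossMoment μ T m k n L i (c, l) =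
      ∑ b, kron L l b * unfold k (fun a => D.factorMoment μ T m n a b) i c := by
  set a := (Equiv.piSplitAt k (fun j => Fin (r m j))).symm (i, c) with ha
  have hint : ∀ t b, Integrable (fun ω => D.G T t m ω a * D.G T t n ω b) μ := fun t b =>
    (memLp_mul_of_four (hCore.memLp_G T t m a) (hCore.memLp_G T t n b)).integrable one_le_two
  have h1 : ∀ t, ∫ ω, unfold k (D.G T t m ω) i c * (kron L).mulVec (D.G T t n ω) l ∂μ =
      ∑ b, kron L l b * ∫ ω, D.G T t m ω a * D.G T t n ω b ∂μ := fun t => by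
    simp only [← integral_const_mul]
    rw [← integral_finsetSum _ fun b _ => (hint t b).const_mul _]
    refine integral_congr_ae (Eventually.of_forall fun ω => ?_)
    simp only [unfold, of_apply, mulVec, dotProduct, Finset.mul_sum, ← ha]
    exact Finset.sum_congr rfl fun b _ => by ring
  simp only [factorCrossMoment, of_apply, h1]
  simp only [unfold, of_apply, factorMoment, ← ha]
  rw [Finset.sum_comm, Finset.mul_sum]
  refine Finset.sum_congr rfl fun b _ => ?_
  rw [← Finset.mul_sum]
  ring

/-- The mean moment matrices in terms of the loadings. -/
lemma unfold_crossMean (D : Model Ω M K r u) (μ : Measure Ω) (T : ℕ) (m n : Fin M) (k : Fin (K m))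
    (i : MIdx (D.p T n)) :
    unfold k (fun I => D.crossMean μ T m n I i) = D.A T m k *
      (∑ b, kron (D.A T n) i b • unfold k fun a => D.factorMoment μ T m n a b) *
        (piKron fun j : {j // j ≠ k} => D.A T m j)ᵀ := by
  have h1 : (∑ b, kron (D.A T n) i b • unfold k fun a => D.factorMoment μ T m n a b) =
      unfold k fun a => ∑ b, kron (D.A T n) i b * D.factorMoment μ T m n a b := by
    ext a c
    simp [unfold, Matrix.sum_apply]
  rw [h1, ← unfold_mulVec_kron]
  congr 1
  ext I
  simp only [crossMean, mulVec, dotProduct, Finset.mul_sum, mul_assoc]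

lemma sum_kron_mulVec_sq_ge {T : ℕ} {n : Fin M} {s : Finset (MIdx (D.p T n))} {a : ℝ} (ha : 0 ≤ a)
    (h : ∀ j < ∏ k, r n k, a * √(s.card : ℝ) ≤ singVal (D.kronRows T n s) j) (y : Tensor (r n)) :
    a ^ 2 * s.card * (y ⬝ᵥ y) ≤ ∑ i ∈ s, (kron (D.A T n) *ᵥ y) i ^ 2 := by
  have h1 := mulVec_sq_ge_of_singVal (D.kronRows T n s) (c := a * √(s.card : ℝ)) (by positivity)
    (by simpa using h) y
  rw [mul_pow, Real.sq_sqrt (Nat.cast_nonneg _)] at h1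
  refine h1.trans (le_of_eq ?_)
  rw [← Finset.sum_coe_sort]
  simp only [dotProduct, ← sq]
  rfl

/-- The signal in the mean moment matrices over an index set on which the Kronecker product of the
loadings is well conditioned. -/
lemma exists_signal_bound [IsFiniteMeasure μ] (hCore : D.CoreFactor μ) {ρ : ℝ} (hρ0 : 0 ≤ ρ)
    (hρ1 : ρ < 1)
    (hρ : ∀ᶠ T in atTop, ∀ m k x,
      (1 - ρ) * D.p T m k * (x ⬝ᵥ x) ≤ (D.A T m k *ᵥ x) ⬝ᵥ (D.A T m k *ᵥ x) ∧
        (D.A T m k *ᵥ x) ⬝ᵥ (D.A T m k *ᵥ x) ≤ (1 + ρ) * D.p T m k * (x ⬝ᵥ x))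
    (m n : Fin M) (k : Fin (K m)) {a : ℝ} (ha : 0 < a) :
    ∃ c : ℝ, 0 < c ∧ ∀ᶠ T in atTop, ∀ s : Finset (MIdx (D.p T n)),
      (∀ j < ∏ k, r n k, a * √(s.card : ℝ) ≤ singVal (D.kronRows T n s) j) →
      ∀ C : Matrix (Fin (r m k)) (Fin (r m k)) ℝ, Cᵀ = C →
        C * ((D.A T m k)ᵀ * D.A T m k) * C = 1 →
        ∃ N : MIdx (D.p T n) → Matrix (Fin (r m k)) (CoIdx (D.p T m) k) ℝ,
          (∀ i, unfold k (fun I => D.crossMean μ T m n I i) = D.A T m k * C * N i) ∧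
          ∀ x, c * (∏ j, (D.p T m j : ℝ)) * s.card * (x ⬝ᵥ x) ≤
            ∑ i ∈ s, ((N i)ᵀ *ᵥ x) ⬝ᵥ ((N i)ᵀ *ᵥ x) := by
  have h1ρ : 0 < 1 - ρ := by linarith
  -- The loadings of thread `n`, divided by the square roots of their dimensions, have singular
  -- values in this interval.
  obtain ⟨c, _, hc, hcF⟩ := hCore.2.2 m k n (√(1 - ρ)) (√(1 + ρ)) (Real.sqrt_pos.2 h1ρ)
    (Real.sqrt_le_sqrt (by linarith))
  -- The `+ 1` keeps this product positive even for a zero factor number; likewise it keeps the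
  -- denominators in `fR` nonzero.
  set fW : ℝ := ∏ h, ((r n h + 1) * (1 + ρ)) with hfW
  have hfWpos : 0 < fW := Finset.prod_pos fun h _ => by positivity
  set fR : ℝ := ∏ j : {j // j ≠ k}, ((1 - ρ) / (r m j + 1)) with hfR
  have hfRpos : 0 < fR := Finset.prod_pos fun j _ => by positivity
  refine ⟨c ^ 2 * a ^ 2 * (1 - ρ) * fR / fW, by positivity, ?_⟩
  filter_upwards [hcF, hρ] with T hT hA s hs C hCt hC
  have hp : ∀ n h, (0 : ℝ) < D.p T n h := fun n h => by exact_mod_cast D.p_pos T n h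
  -- the other loadings of thread `m`
  set Q := piKron fun j : {j // j ≠ k} => D.A T m j with hQ
  choose Li hLi hLif using fun j : {j // j ≠ k} =>
    exists_leftInverse (D.A T m j) (mul_pos h1ρ (hp m j)) fun x => (hA m j x).1
  set fP : ℝ := ∏ j : {j // j ≠ k}, (D.p T m j : ℝ) with hfP
  have hfPpos : 0 < fP := Finset.prod_pos fun j _ => hp m j
  have hfQ : ∏ j, frobSq (Li j) ≤ (fR * fP)⁻¹ := by
    rw [hfR, hfP, ← Finset.prod_mul_distrib, ← Finset.prod_inv_distrib]
    refine Finset.prod_le_prod (fun j _ => frobSq_nonneg _) fun j _ => (hLif j).trans ?_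
    rw [Fintype.card_fin, div_mul_eq_mul_div, inv_div]
    have := hp m j
    gcongr
    linarith
  have hQy : ∀ y, y ⬝ᵥ y ≤ (fR * fP)⁻¹ * ((Q *ᵥ y) ⬝ᵥ (Q *ᵥ y)) := fun y =>
    (le_piKron_mulVec_sq _ Li hLi y).trans
      (mul_le_mul_of_nonneg_right hfQ (dotProduct_self_nonneg' _))
  -- normalized loadings of thread `n`
  set L : ∀ h, Matrix (Fin (D.p T n h)) (Fin (r n h)) ℝ :=
    fun h => (√(D.p T n h : ℝ))⁻¹ • D.A T n h with hL
  have hLq : ∀ h x, (1 - ρ) * (x ⬝ᵥ x) ≤ (L h *ᵥ x) ⬝ᵥ (L h *ᵥ x) ∧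
      (L h *ᵥ x) ⬝ᵥ (L h *ᵥ x) ≤ (1 + ρ) * (x ⬝ᵥ x) := fun h x => by
    have h1 : (L h *ᵥ x) ⬝ᵥ (L h *ᵥ x) =
        ((D.A T n h *ᵥ x) ⬝ᵥ (D.A T n h *ᵥ x)) / D.p T n h := by
      rw [hL]
      simp only [smul_mulVec, smul_dotProduct, dotProduct_smul, smul_eq_mul]
      rw [← mul_assoc, ← mul_inv, Real.mul_self_sqrt (hp n h).le]
      ring
    obtain ⟨h2, h3⟩ := hA n h x
    rw [h1, le_div_iff₀ (hp n h), div_le_iff₀ (hp n h)]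
    constructor <;> nlinarith
  have hW : frobSq (kron L) ≤ fW := by
    have h1 : frobSq (kron L) = ∏ h, frobSq (L h) := frobSq_piKron L
    rw [h1]
    refine Finset.prod_le_prod (fun h _ => frobSq_nonneg _) fun h _ => ?_
    refine (frobSq_le_of_mulVec_sq_le _ fun x => (hLq h x).2).trans ?_
    rw [Fintype.card_fin]
    gcongr
    linarith
  have hF : ∀ z, c ^ 2 * (z ⬝ᵥ z) ≤ ((D.factorCrossMoment μ T m k n L)ᵀ *ᵥ z) ⬝ᵥ
      ((D.factorCrossMoment μ T m k n L)ᵀ *ᵥ z) := by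
    refine transpose_mulVec_sq_ge_of_singVal _ hc fun j hj => ?_
    exact (hT L (fun h j hj => singVal_mem_of_mulVec_sq _ (hLq h) (by simpa using hj)) j
      (by simpa using hj)).1
  set Γ := fun b => unfold k fun a => D.factorMoment μ T m n a b with hΓ
  -- From `C (AᵀA) C = 1` follows `C C AᵀA = 1`, so `A = (A C)(C AᵀA)`.
  refine ⟨fun i => C * ((D.A T m k)ᵀ * D.A T m k) * (∑ b, kron (D.A T n) i b • Γ b) * Qᵀ,
    fun i => ?_, fun x => ?_⟩
  · have h1 : C * (C * ((D.A T m k)ᵀ * D.A T m k)) = 1 := mul_eq_one_comm.1 hC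
    rw [unfold_crossMean]
    calc _ = D.A T m k * (C * (C * ((D.A T m k)ᵀ * D.A T m k))) *
          (∑ b, kron (D.A T n) i b • Γ b) * Qᵀ := by rw [h1, Matrix.mul_one]
      _ = _ := by simp only [Matrix.mul_assoc]
  -- `z` is `C⁻¹ x`, and its norm is that of `A x`, which gains the factor `p_{m,k}`.
  · set z := ((D.A T m k)ᵀ * D.A T m k * C) *ᵥ x with hz
    have hNt : ∀ Φ : Matrix (Fin (r m k)) (CoIdx (r m) k) ℝ,
        (C * ((D.A T m k)ᵀ * D.A T m k) * Φ * Qᵀ)ᵀ *ᵥ x = Q *ᵥ (Φᵀ *ᵥ z) := fun Φ => by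
      rw [hz, mulVec_mulVec, mulVec_mulVec, transpose_mul, transpose_mul, transpose_mul,
        transpose_mul, transpose_transpose, transpose_transpose, hCt, Matrix.mul_assoc Q]
    have hNx := fun i => hNt (∑ b, kron (D.A T n) i b • Γ b)
    have hsig := signal_lower_bound s (kron (D.A T n)) Γ Q (kron L)
      (D.factorCrossMoment μ T m k n L) (factorCrossMoment_apply hCore T m k n L)
      (by positivity) hfWpos.le hQy (sum_kron_mulVec_sq_ge ha.le hs) hW z (hF z)
    have hCz : C *ᵥ z = x := by
      rw [hz, mulVec_mulVec, ← Matrix.mul_assoc, hC, one_mulVec]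
    have hzx : (1 - ρ) * D.p T m k * (x ⬝ᵥ x) ≤ z ⬝ᵥ z := by
      have h1 := (hA m k (C *ᵥ z)).1
      have h2 : (D.A T m k *ᵥ (C *ᵥ z)) ⬝ᵥ (D.A T m k *ᵥ (C *ᵥ z)) = z ⬝ᵥ z := by
        rw [mulVec_dotProduct_mulVec, mulVec_dotProduct_mulVec, hCt]
        have h3 : C * ((D.A T m k)ᵀ * (D.A T m k * C)) = 1 := by
          rw [← hC]; simp only [Matrix.mul_assoc]
        simp only [mulVec_mulVec, h3, one_mulVec]
      rwa [h2, hCz] at h1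
    simp only [hNx]
    have hprod : ∏ j, (D.p T m j : ℝ) = D.p T m k * fP := Fintype.prod_eq_mul_prod_subtype_ne _ k
    rw [hprod]
    have hpk := hp m k
    calc c ^ 2 * a ^ 2 * (1 - ρ) * fR / fW * (D.p T m k * fP) * s.card * (x ⬝ᵥ x)
        = (c ^ 2 * (a ^ 2 * s.card) * ((1 - ρ) * D.p T m k * (x ⬝ᵥ x))) * (fR * fP / fW) := by
          ring
      _ ≤ (c ^ 2 * (a ^ 2 * s.card) * (z ⬝ᵥ z)) * (fR * fP / fW) := by gcongr
      _ ≤ (fW * (fR * fP)⁻¹ * ∑ i ∈ s, (Q *ᵥ ((∑ b, kron (D.A T n) i b • Γ b)ᵀ *ᵥ z)) ⬝ᵥ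
          (Q *ᵥ ((∑ b, kron (D.A T n) i b • Γ b)ᵀ *ᵥ z))) * (fR * fP / fW) :=
        mul_le_mul_of_nonneg_right hsig (by positivity)
      _ = _ := by field_simp

end Model

/-! ### Alignment and the rate of convergence -/

open Matrix in
/-- Alignment of a matrix of orthonormal columns with a loading matrix. -/
lemma exists_alignment {p r : ℕ} (hp : 0 < p) (A V : Matrix (Fin p) (Fin r) ℝ)
    (C : Matrix (Fin r) (Fin r) ℝ) (hU : (A * C)ᵀ * (A * C) = 1) (hV : Vᵀ * V = 1) :
    ∃ H : Matrix (Fin r) (Fin r) ℝ, (A * H)ᵀ * (A * H) = (p : ℝ) • 1 ∧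
      (frobSq (V - A * C * ((A * C)ᵀ * V)) < 1 → (p : ℝ)⁻¹ * frobSq (√(p : ℝ) • V - A * H) ≤
        2 * frobSq (V - A * C * ((A * C)ᵀ * V))) := by
  have hp' : (0 : ℝ) < p := by exact_mod_cast hp
  have hAH : ∀ O : Matrix (Fin r) (Fin r) ℝ, Oᵀ * O = 1 →
      (A * (√(p : ℝ) • (C * O)))ᵀ * (A * (√(p : ℝ) • (C * O))) = (p : ℝ) • 1 := fun O hO => by
    rw [Matrix.mul_smul, transpose_smul, Matrix.smul_mul, Matrix.mul_smul, smul_smul,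
      Real.mul_self_sqrt hp'.le, ← Matrix.mul_assoc A C O, transpose_mul (A * C), Matrix.mul_assoc,
      ← Matrix.mul_assoc (A * C)ᵀ, hU, Matrix.one_mul, hO]
  by_cases hδ : frobSq (V - A * C * ((A * C)ᵀ * V)) < 1
  · obtain ⟨O, hO, hle⟩ := exists_rotation (A * C) V hU hV le_rfl hδ
    refine ⟨√(p : ℝ) • (C * O), hAH O hO, fun _ => ?_⟩
    have h1 : √(p : ℝ) • V - A * (√(p : ℝ) • (C * O)) = √(p : ℝ) • (V - A * C * O) := by
      rw [Matrix.mul_smul, smul_sub, Matrix.mul_assoc]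
    rw [h1, frobSq_smul, Real.sq_sqrt hp'.le, ← mul_assoc, inv_mul_cancel₀ hp'.ne', one_mul]
    exact hle
  -- Without closeness any rotation serves: only the normalization is claimed.
  · exact ⟨√(p : ℝ) • (C * 1), hAH 1 (by simp), fun h => absurd h hδ⟩

namespace Model

open Matrix

variable {Ω : Type*} [MeasurableSpace Ω] {M : ℕ} {K : Fin M → ℕ} {r u : ∀ m, Fin (K m) → ℕ}
  {D : Model Ω M K r u} {μ : Measure Ω}

/-- The estimation error on the event where the moment matrices are close to their means and
carry a strong signal. -/
lemma estimation_error_le {T : ℕ} {m : Fin M} {k : Fin (K m)} {ω : Ω}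
    {S : ∀ n : {n : Fin M // n ≠ m}, Finset (MIdx (D.p T n))} {C : Matrix (Fin (r m k)) (Fin (r m k)) ℝ}
    (hU : (D.A T m k * C)ᵀ * (D.A T m k * C) = 1) {V : Matrix (Fin (D.p T m k)) (Fin (r m k)) ℝ}
    (hV : IsLeadingEigenvectors (D.SigmaHatS T m k S ω) V) {c e : ℝ} (hc : 0 < c) (hec : 4 * e ≤ c)
    (hne : 0 < (Finset.univ.sigma S).card)
    (hsig : ∀ n : {n : Fin M // n ≠ m},
      ∃ N : MIdx (D.p T n) → Matrix (Fin (r m k)) (CoIdx (D.p T m) k) ℝ,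
        (∀ i, unfold k (fun I => D.crossMean μ T m n I i) = D.A T m k * C * N i) ∧
        ∀ x, c * (∏ j, (D.p T m j : ℝ)) * (S n).card * (x ⬝ᵥ x) ≤
          ∑ i ∈ S n, ((N i)ᵀ *ᵥ x) ⬝ᵥ ((N i)ᵀ *ᵥ x))
    (herr : ∑ q ∈ Finset.univ.sigma S, frobSq (D.OmegaHat T m k q.1 q.2 ω -
        unfold k fun I => D.crossMean μ T m q.1 I q.2) ≤
      e * (∏ j, (D.p T m j : ℝ)) * (Finset.univ.sigma S).card) :
    frobSq (V - D.A T m k * C * ((D.A T m k * C)ᵀ * V)) ≤ r m k * (4 * e / c) := by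
  choose N hN hNx using hsig
  have hp : 0 < ∏ j, (D.p T m j : ℝ) :=
    Finset.prod_pos fun j _ => by exact_mod_cast D.p_pos T m j
  have hcard : (0 : ℝ) < (Finset.univ.sigma S).card := by exact_mod_cast hne
  set P := ∏ j, (D.p T m j : ℝ)
  set s := Finset.univ.sigma S with hs
  -- The perturbation bound asks for a signal of `4 L`.
  have hL : 0 < c / 4 * P * s.card := by positivity
  have h := leadingEigenvectors_perturbation s (fun q => D.OmegaHat T m k q.1 q.2 ω)
    (fun q => D.OmegaHat T m k q.1 q.2 ω - unfold k fun I => D.crossMean μ T m q.1 I q.2)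
    (fun q => N q.1 q.2) (D.A T m k * C) V hU (fun q => by rw [hN]; abel)
    (by rw [hs, Finset.sum_sigma]; exact hV) hL
    (mul_le_mul_of_nonneg_right (mul_le_mul_of_nonneg_right (by linarith) hp.le) hcard.le) herr
    (fun x => by
      rw [hs, Finset.sum_sigma]
      refine le_trans (le_of_eq ?_) (Finset.sum_le_sum fun n _ => hNx n x)
      rw [Finset.card_sigma, Nat.cast_sum, ← Finset.sum_mul, ← Finset.mul_sum]
      ring)
  refine h.2.trans (le_of_eq ?_)
  congr 1
  field_simp

end Model

end MultiOrderTFM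

open MultiOrderTFM in
theorem theorem6 {Ω : Type*} [MeasurableSpace Ω] (μ : Measure Ω) [IsProbabilityMeasure μ]
    (M : ℕ) (hM : 1 < M) (K : Fin M → ℕ) (r u : ∀ m, Fin (K m) → ℕ)
    (D : Model Ω M K r u)
    (hIdent : D.Identification μ) (hLoad : D.Loadings) (hGram : D.LoadingsNondegenerate)
    (hCore : D.CoreFactor μ) (hNoise : D.Noise μ) (hAcross : D.AcrossThreads μ)
    (m : Fin M)
    (S : ∀ T, Ω → ∀ n : {n : Fin M // n ≠ m}, Finset (MIdx (D.p T n)))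
    (hS : D.RandomSubsets μ m S) (hRank : D.SubsetRank μ m S)
    (k : Fin (K m))
    (Ahat : ∀ T, Ω → Matrix (Fin (D.p T m k)) (Fin (r m k)) ℝ)
    (hAhat : ∀ᶠ T in atTop, ∀ ω, D.IsLoadingEstimator T m k (S T ω) ω (Ahat T ω)) :
    ∃ H : ℕ → Ω → Matrix (Fin (r m k)) (Fin (r m k)) ℝ,
      (∀ᶠ T in atTop, ∀ ω,
        (D.A T m k * H T ω).transpose * (D.A T m k * H T ω) = (D.p T m k : ℝ) • 1) ∧
      IsBigOP μ
        (fun T ω => (D.p T m k : ℝ)⁻¹ * frobSq (Ahat T ω - D.A T m k * H T ω))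
        (fun T => 1 / (T : ℝ)) := by
  classical
  obtain ⟨ρ, hρ0, hρ1, hρ⟩ := hGram.exists_quadForm
  have hp : ∀ T n h, (0 : ℝ) < D.p T n h := fun T n h => by exact_mod_cast D.p_pos T n h
  have hC : ∀ T, ∃ C : Matrix (Fin (r m k)) (Fin (r m k)) ℝ,
      (∀ m k x, (1 - ρ) * D.p T m k * (x ⬝ᵥ x) ≤ ((D.A T m k).mulVec x) ⬝ᵥ ((D.A T m k).mulVec x) ∧
        ((D.A T m k).mulVec x) ⬝ᵥ ((D.A T m k).mulVec x) ≤ (1 + ρ) * D.p T m k * (x ⬝ᵥ x)) →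
      C.transpose = C ∧ C * ((D.A T m k).transpose * D.A T m k) * C = 1 := fun T => by
    by_cases h : ∀ m k x,
        (1 - ρ) * D.p T m k * (x ⬝ᵥ x) ≤ ((D.A T m k).mulVec x) ⬝ᵥ ((D.A T m k).mulVec x) ∧
        ((D.A T m k).mulVec x) ⬝ᵥ ((D.A T m k).mulVec x) ≤ (1 + ρ) * D.p T m k * (x ⬝ᵥ x)
    · obtain ⟨C, h1, h2⟩ := exists_orthonormalization (D.A T m k)
        (mul_pos (sub_pos.2 hρ1) (hp T m k)) fun x => (h m k x).1
      exact ⟨C, fun _ => ⟨h1, h2⟩⟩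
    · exact ⟨0, fun h' => absurd h' h⟩
  choose C hC using hC
  let U := fun T => D.A T m k * C T
  have hU : ∀ᶠ T in atTop, (U T).transpose * U T = 1 := by
    filter_upwards [hρ] with T hT
    obtain ⟨h1, h2⟩ := hC T hT
    simp only [U]
    rw [Matrix.transpose_mul, h1, ← h2]
    simp only [Matrix.mul_assoc]
  have hH : ∀ T ω, ∃ H : Matrix (Fin (r m k)) (Fin (r m k)) ℝ, (U T).transpose * U T = 1 →
      D.IsLoadingEstimator T m k (S T ω) ω (Ahat T ω) →
      (D.A T m k * H).transpose * (D.A T m k * H) = (D.p T m k : ℝ) • 1 ∧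
      ∃ V, IsLeadingEigenvectors (D.SigmaHatS T m k (S T ω) ω) V ∧
        (frobSq (V - U T * ((U T).transpose * V)) < 1 →
          (D.p T m k : ℝ)⁻¹ * frobSq (Ahat T ω - D.A T m k * H) ≤
            2 * frobSq (V - U T * ((U T).transpose * V))) := fun T ω => by
    by_cases h : (U T).transpose * U T = 1 ∧ D.IsLoadingEstimator T m k (S T ω) ω (Ahat T ω)
    · obtain ⟨hUT, V, hV, hVA⟩ := h
      obtain ⟨_, hVV, -⟩ := hV.exists_eigenvalues
      obtain ⟨H, h1, h2⟩ := exists_alignment (D.p_pos T m k) (D.A T m k) V (C T) hUT hVV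
      exact ⟨H, fun _ _ => ⟨h1, V, hV, hVA ▸ h2⟩⟩
    · exact ⟨0, fun h1 h2 => absurd ⟨h1, h2⟩ h⟩
  choose H hH using hH
  refine ⟨H, ?_, fun ε hε => ?_⟩
  · filter_upwards [hU, hAhat] with T h1 h2 ω
    exact (hH T ω h1 (h2 ω)).1
  -- constants
  obtain ⟨v, hv, hmom⟩ : ∃ v : ℝ, 0 < v ∧ ∀ n, n ≠ m → ∀ T : ℕ, 0 < T → ∀ I i,
      MomentBound μ (fun ω => (T : ℝ)⁻¹ * ∑ t, D.X T t m ω I * D.X T t n ω i)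
        (D.crossMean μ T m n I i) (v / T) := by
    have h : ∀ n : {n // n ≠ m}, ∃ v : ℝ, ∀ T : ℕ, 0 < T → ∀ I i,
        MomentBound μ (fun ω => (T : ℝ)⁻¹ * ∑ t, D.X T t m ω I * D.X T t n ω i)
          (D.crossMean μ T m n I i) (v / T) := fun n =>
      Model.exists_momentBound hIdent hLoad hCore hNoise hAcross n.2
    choose v hv using h
    obtain ⟨v', hv'⟩ := Finite.exists_le v
    refine ⟨max v' 1, by positivity, fun n hn T hT I i => (hv ⟨n, hn⟩ T hT I i).mono ?_⟩
    gcongr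
    exact (hv' ⟨n, hn⟩).trans (le_max_left _ _)
  have hM0 : (0 : ℝ) < M := by exact_mod_cast (zero_lt_one.trans hM)
  -- The budget is `ε / 3` for each bad event: ill-conditioned rows (shared among at most `M`
  -- threads), all sets empty, and a large moment error (whence `κ = 3 / ε`).
  choose a b ha hab using fun n => hRank n (ε / (3 * M)) (by positivity)
  choose c₀ hc₀ hsig₀ using fun n : {n // n ≠ m} =>
    Model.exists_signal_bound hCore hρ0 hρ1 hρ m n k (ha n)
  obtain ⟨c, hc, hcle⟩ : ∃ c : ℝ, 0 < c ∧ ∀ n, c ≤ c₀ n := by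
    have : Nonempty (Set.Ioi (0 : ℝ)) := ⟨⟨1, by simp⟩⟩
    obtain ⟨⟨c, hc⟩, h⟩ := Finite.exists_ge fun n => (⟨c₀ n, hc₀ n⟩ : Set.Ioi (0 : ℝ))
    exact ⟨c, hc, fun n => h n⟩
  set κ : ℝ := 3 / ε with hκ
  have hκpos : 0 < κ := by positivity
  set c₁ : ℝ := r m k * (4 * (κ * v) / c) with hc₁
  have hc₁0 : 0 ≤ c₁ := by positivity
  -- The factor 2 comes from the rotation; the 1 keeps the constant positive when `c₁` is zero.
  refine ⟨2 * c₁ + 1, by positivity, ?_⟩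
  -- The first threshold puts the error below a quarter of the signal constant, the second puts the
  -- column-space distance below one, as the rotation requires.
  have hbig₁ : ∀ᶠ T : ℕ in atTop, 4 * (κ * v) / c < T :=
    tendsto_natCast_atTop_atTop.eventually_gt_atTop _
  have hbig₂ : ∀ᶠ T : ℕ in atTop, c₁ < T := tendsto_natCast_atTop_atTop.eventually_gt_atTop _
  have hempty : ∀ᶠ T in atTop, μ {ω | ∀ n, S T ω n = ∅} ≤ ENNReal.ofReal (ε / 3) :=
    (hS.2.2.eventually_lt_const (by simpa using hε)).mono fun _ h => h.le
  have hsig := eventually_all.2 hsig₀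
  have hab' := eventually_all.2 hab
  filter_upwards [hρ, hU, hAhat, hbig₁, hbig₂, hempty, hsig, hab', eventually_gt_atTop 0] with T
    hρT hUT hAT hT₁ hT₂ hET hsT habT hT0
  have hT0' : (0 : ℝ) < T := by exact_mod_cast hT0
  have herr := Model.measure_momentError_le hv hT0 (fun n hn => hmom n hn T hT0) (S T) (hS.1 T)
    (hS.2.1 T) k hκpos
  have hrank : μ (⋃ n : {n : Fin M // n ≠ m}, {ω | ¬ ∀ j < ∏ k, r n k,
      a n * √((S T ω n).card : ℝ) ≤ singVal (D.kronRows T n (S T ω n)) j ∧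
      singVal (D.kronRows T n (S T ω n)) j ≤ b n * √((S T ω n).card : ℝ)}) ≤
      ENNReal.ofReal (ε / 3) := by
    refine (measure_iUnion_fintype_le _ _).trans ((Finset.sum_le_sum fun n _ => habT n).trans ?_)
    rw [Finset.sum_const, nsmul_eq_mul, ← ENNReal.ofReal_natCast, ← ENNReal.ofReal_mul (by simp)]
    refine ENNReal.ofReal_le_ofReal ?_
    have h1 : ((Finset.univ : Finset {n : Fin M // n ≠ m}).card : ℝ) ≤ M := by
      have := Fintype.card_subtype_le fun n : Fin M => n ≠ m
      rw [Fintype.card_fin] at this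
      exact_mod_cast this
    calc _ ≤ (M : ℝ) * (ε / (3 * M)) := by gcongr
      _ = ε / 3 := by field_simp
  have hκinv : κ⁻¹ = ε / 3 := by rw [hκ, inv_div]
  rw [hκinv] at herr
  refine le_trans ?_ (le_of_eq (show ENNReal.ofReal (ε / 3) + ENNReal.ofReal (ε / 3) +
    ENNReal.ofReal (ε / 3) = ENNReal.ofReal ε by
      rw [← ENNReal.ofReal_add (by positivity) (by positivity),
        ← ENNReal.ofReal_add (by positivity) (by positivity)]
      congr 1; ring))
  refine le_trans ?_ (add_le_add (add_le_add hET hrank) herr)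
  -- Off the three bad events the bound holds pointwise; monotonicity of `μ` on arbitrary sets needs
  -- no measurability of `Ahat` or `H`.
  refine le_trans (measure_mono ?_) ((measure_union_le _ _).trans
    (add_le_add_left (measure_union_le _ _) _))
  intro ω hω
  by_contra hgood
  simp only [Set.mem_union, Set.mem_iUnion, Set.mem_ofPred_eq, not_or, not_exists, not_not,
    not_lt] at hgood hω
  obtain ⟨⟨hne, hrk⟩, he⟩ := hgood
  obtain ⟨n, hn⟩ := not_forall.1 hne
  have hcard : 0 < (Finset.univ.sigma (S T ω)).card := by
    rw [Finset.card_sigma]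
    exact (Finset.card_pos.2 (Finset.nonempty_iff_ne_empty.2 hn)).trans_le
      (Finset.single_le_sum (f := fun n => (S T ω n).card) (fun _ _ => Nat.zero_le _)
        (Finset.mem_univ n))
  obtain ⟨-, V, hV, hVle⟩ := hH T ω hUT (hAT ω)
  obtain ⟨hCt, hCC⟩ := hC T hρT
  have hprod : (0 : ℝ) ≤ ∏ j, (D.p T m j : ℝ) := Finset.prod_nonneg fun j _ => (hp T m j).le
  have hδ := Model.estimation_error_le (μ := μ) hUT hV hc (e := κ * v / T)
    (by
      rw [div_lt_iff₀ hc] at hT₁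
      rw [mul_div_assoc', div_le_iff₀ hT0']
      linarith) hcard
    (fun n => by
      obtain ⟨N, hN, hNx⟩ := hsT n (S T ω n) (fun j hj => (hrk n j hj).1) (C T) hCt hCC
      refine ⟨N, hN, fun x => le_trans ?_ (hNx x)⟩
      have := dotProduct_self_nonneg' x
      have := hcle n
      gcongr)
    (he.trans (le_of_eq (by ring)))
  have hδ' : frobSq (V - U T * ((U T).transpose * V)) ≤ c₁ / T :=
    hδ.trans (le_of_eq (by rw [hc₁]; ring))
  have h1 := hVle (hδ'.trans_lt ((div_lt_one hT0').2 hT₂))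
  rw [abs_of_nonneg (mul_nonneg (inv_nonneg.2 (hp T m k).le) (frobSq_nonneg _))] at hω
  have h2 : (2 * c₁ + 1) * (1 / (T : ℝ)) = 2 * (c₁ / T) + 1 / T := by ring
  have h3 : 0 < 1 / (T : ℝ) := by positivity
  linarith
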